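/- Let $n,m,k$ be positive integers and $s>0$. Write $\mathcal L^n$ for Lebesgue measure and $\mathcal H^s$ for $s$-dimensional Hausdorff measure on $\mathbb R^n$. A function $f:\mathbb R^n\to\mathbb R^m$ is called approximately differentiable of order $k$ at $x$ if there is a polynomial $$p_k(x;y)=\sum_{|\alpha|\le k}\frac{f_\alpha(x)}{\alpha!}(y-x)^\alpha ,\qquad f_\alpha(x)\in\mathbb R^m,$$ such that for every $\varepsilon>0$ $$\lim_{r\to0^+}\frac{\mathcal L^n\big(\{y\in B(x,r): |f(y)-p_k(x;y)|\ge\varepsilon|y-x|^k\}\big)}{\mathcal L^n(B(x,r))}=0 .$$ For measurable $f$ this polynomial is unique; the vectors $f_\alpha(x)$, $|\alpha|\le k$, are called the differential coefficients of $f$ at $x$ (thus $f_0(x)$ is the approximate limit of $f$ at $x$). Let $f:\mathbb R^n\to\mathbb R^m$ be a Borel function and let $B\subseteq\mathbb R^n$ be a Borel set with $\mathcal H^s(B)<\infty$. Suppose that $f$ is approximately differentiable of order $k$ at $\mathcal H^s$-almost every point of $B$, and that for each $|\alpha|\le k$ the coefficient $x\mapsto f_\alpha(x)$ is a Borel function on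 the set of points of $B$ at which $f$ is approximately differentiable of order $k$ (with the relative Borel $\sigma$-algebra). Then there are sets $B_1,B_2,\ldots$ and $N$ with $$B=\bigcup_{j=1}^\infty B_j\cup N,\qquad \mathcal H^s(N)=0,$$ such that for each $j$ there is a function $g_j\in C^k(\mathbb R^n;\mathbb R^m)$ for which, at every $x\in B_j$, $f$ is approximately differentiable of order $k$ and $f_\alpha(x)=D^\alpha g_j(x)$ for all $|\alpha|\le k$. -/

import Mathlib

open MeasureTheory Filter Topology

/-- `ℝⁿ` with its Euclidean norm. -/
abbrev Rn (n : ℕ) : Type := EuclideanSpace ℝ (Fin n)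

/-- The (finite) set of multi-indices `α ∈ ℕⁿ` with `|α| = α₁ + ⋯ + αₙ ≤ k`. -/
def multiIndices (n k : ℕ) : Finset (Fin n → ℕ) :=
  (Fintype.piFinset fun _ : Fin n => Finset.range (k + 1)).filter fun α => ∑ i, α i ≤ k

theorem mem_multiIndices {n k : ℕ} {α : Fin n → ℕ} :
    α ∈ multiIndices n k ↔ ∑ i, α i ≤ k := by
  simp only [multiIndices, Finset.mem_filter, Fintype.mem_piFinset, Finset.mem_range,
    and_iff_right_iff_imp]
  intro h i
  have : α i ≤ ∑ i, α i := Finset.single_le_sum (fun _ _ => Nat.zero_le _) (Finset.mem_univ i)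
  omega

/-- The polynomial `y ↦ ∑_{|α| ≤ k} (c_α / α!) (y - x)^α`, centered at `x`, of degree at most `k`,
with coefficients `c_α ∈ ℝᵐ`. -/
noncomputable def centeredPoly {n m : ℕ} (k : ℕ) (c : (Fin n → ℕ) → Rn m) (x y : Rn n) : Rn m :=
  ∑ α ∈ multiIndices n k,
    ((∏ i, (y i - x i) ^ α i) / (∏ i, ((α i).factorial : ℝ))) • c α

/-- `ap lim_{y → x} h y = l`: for every `ε > 0`,
`ℒⁿ(B(x,r) ∩ {y | |h y - l| ≥ ε}) / ℒⁿ(B(x,r)) → 0` as `r → 0⁺`. -/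
def ApTendsto {n : ℕ} (h : Rn n → ℝ) (x : Rn n) (l : ℝ) : Prop :=
  ∀ ε : ℝ, 0 < ε →
    Tendsto (fun r : ℝ =>
        volume (Metric.ball x r ∩ {y | ε ≤ |h y - l|}) / volume (Metric.ball x r))
      (𝓝[>] 0) (𝓝 0)

/-- The polynomial with coefficients `c`, centered at `x`, approximates `f` to order `k` at `x`:
`ap lim_{y → x} |f y - p(x; y)| / |y - x|^k = 0`. -/
def HasApproxTaylorAt {n m : ℕ} (k : ℕ) (f : Rn n → Rn m) (c : (Fin n → ℕ) → Rn m)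
    (x : Rn n) : Prop :=
  ApTendsto (fun y => ‖f y - centeredPoly k c x y‖ / ‖y - x‖ ^ k) x 0

/-- `f` is approximately differentiable of order `k` at `x`. -/
def ApproxDifferentiableAt {n m : ℕ} (k : ℕ) (f : Rn n → Rn m) (x : Rn n) : Prop :=
  ∃ c : (Fin n → ℕ) → Rn m, HasApproxTaylorAt k f c x

open Classical in
/-- The `α`-th differential coefficient `f_α(x)` (for `|α| ≤ k`) of `f` at a point `x` at which `f`
is approximately differentiable of order `k`. The value `0` at all other points is a placeholder. -/
noncomputable def approxCoeff {n m : ℕ} (k : ℕ) (f : Rn n → Rn m) (α : Fin n → ℕ)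
    (x : Rn n) : Rn m :=
  if h : ApproxDifferentiableAt k f x then h.choose α else 0

/-- The partial derivative `D^α g (x) = ∂₁^{α₁} ⋯ ∂ₙ^{αₙ} g (x)` of a function `g` of class `C^k`,
`|α| ≤ k`: the derivative of order `|α|` evaluated at `α₁` copies of `e₁`, …, `αₙ` copies of `eₙ`. -/
noncomputable def multiDeriv {n m : ℕ} (α : Fin n → ℕ) (g : Rn n → Rn m) (x : Rn n) : Rn m :=
  iteratedFDeriv ℝ (∑ i, α i) g x
    fun j => EuclideanSpace.single (finSigmaFinEquiv.symm j).1 (1 : ℝ)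

/-! The statement combines an Egorov argument with Whitney's extension theorem. After a Borel null
set is removed, every remaining point has a Taylor polynomial whose coefficients depend measurably
on the point. Fix a small density threshold `η`. For each accuracy `1/(i+1)`, the set where `f`
deviates from the polynomial occupies at most the fraction `η` of every sufficiently small dyadic
ball. Since `μH[s]` restricted to `B` is finite, `exists_isCompact_exhaustion` gives compact sets
that fill the rest of `B` up to a null set. On each of them, the scale at which this bound begins is
uniform for every `i`.

Such a compact set carries a Whitney field (`exists_density_isWhitneyField`). If `a` and `b` lie
within `ρ` of `x`, the two exceptional sets are too small to contain any ball of radius comparable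
to `ρ` near `x`. So on a `δρ`-dense part of the ball around `x`, both polynomials are close to `f`,
hence to each other. Their difference belongs to a finite-dimensional space of polynomials, and
`polyFun.exists_norm_iteratedFDeriv_le` turns smallness on a dense set into bounds for all
derivatives. The threshold `η` depends only on `n`, `m`, `k`; only the accuracy has to tend to zero.

`IsWhitneyField.exists_contDiff` then produces a `C^k` function with the prescribed jets, and
`multiDeriv_centeredPoly` identifies these jets with the coefficients. The extension glues the
polynomials with a two-level partition of unity, dyadic shells around `K` refined by nearest-point
cells. Its derivative bounds come from the integral of one bump over disjoint cells, so no
bounded-overlap count of cubes is needed. -/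

theorem natCast_le_smooth (n : ℕ) : (n : WithTop ℕ∞) ≤ ((⊤ : ℕ∞) : WithTop ℕ∞) := by
  exact_mod_cast le_top

/-! ### Polynomial functions and norm equivalence in finite dimension. -/

section PolynomialFunctions

variable {E F : Type} [NormedAddCommGroup E] [NormedSpace ℝ E]
  [NormedAddCommGroup F] [NormedSpace ℝ F]

/-- The smooth functions whose derivative of order `k + 1` vanishes. -/
def polyFun (E F : Type) [NormedAddCommGroup E] [NormedSpace ℝ E]
    [NormedAddCommGroup F] [NormedSpace ℝ F] (k : ℕ) : Submodule ℝ (E → F) where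
  carrier := {Q | ContDiff ℝ (⊤ : ℕ∞) Q ∧ ∀ x, iteratedFDeriv ℝ (k + 1) Q x = 0}
  zero_mem' := ⟨contDiff_const, fun x => by simp⟩
  add_mem' := by
    rintro P Q ⟨hP, hP'⟩ ⟨hQ, hQ'⟩
    refine ⟨hP.add hQ, fun x => ?_⟩
    rw [iteratedFDeriv_add_apply (hP.contDiffAt.of_le (by exact_mod_cast le_top))
      (hQ.contDiffAt.of_le (by exact_mod_cast le_top)), hP', hQ', add_zero]
  smul_mem' := by
    rintro c P ⟨hP, hP'⟩
    refine ⟨contDiff_const.smul hP, fun x => ?_⟩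
    rw [iteratedFDeriv_const_smul_apply (hP.contDiffAt.of_le (by exact_mod_cast le_top)), hP',
      smul_zero]

theorem polyFun.contDiff {k : ℕ} {Q : E → F} (hQ : Q ∈ polyFun E F k) {n : ℕ∞} :
    ContDiff ℝ n Q := hQ.1.of_le (by exact_mod_cast le_top)

theorem iteratedFDeriv_eq_zero_of_le {Q : E → F} {i j : ℕ} (hij : i ≤ j)
    (h : ∀ x, iteratedFDeriv ℝ i Q x = 0) (x : E) : iteratedFDeriv ℝ j Q x = 0 := by
  induction j, hij using Nat.le_induction generalizing x with
  | base => exact h x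
  | succ j hj ih =>
    have : iteratedFDeriv ℝ j Q = fun _ => 0 := funext ih
    ext v
    rw [iteratedFDeriv_succ_apply_left, this]
    simp

/-- A polynomial function with vanishing jet at a point is zero. -/
theorem polyFun.eq_zero_of_jet {k : ℕ} {Q : E → F} (hQ : Q ∈ polyFun E F k) (a : E)
    (h : ∀ j ≤ k, iteratedFDeriv ℝ j Q a = 0) : Q = 0 := by
  -- Descending induction on the order: once a derivative vanishes identically, the one below it is
  -- constant and takes its value at `a`, which is zero.
  have key : ∀ i ≤ k + 1, ∀ x, iteratedFDeriv ℝ (k + 1 - i) Q x = 0 := by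
    intro i
    induction i with
    | zero => intro _ x; exact hQ.2 x
    | succ i ih =>
      intro hi x
      have hs : k + 1 - i = (k + 1 - (i + 1)) + 1 := by omega
      have ih' := ih (by omega)
      rw [hs] at ih'
      have hd : Differentiable ℝ (iteratedFDeriv ℝ (k + 1 - (i + 1)) Q) :=
        (hQ.1.of_le (m := ((k + 1 - (i + 1) + 1 : ℕ) : WithTop ℕ∞))
        (natCast_le_smooth _)).differentiable_iteratedFDeriv
        (Nat.cast_lt.2 (Nat.lt_succ_self (k + 1 - (i + 1))))
      have hconst := is_const_of_fderiv_eq_zero hd (fun y => by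
        rw [← norm_eq_zero, norm_fderiv_iteratedFDeriv, ih' y, norm_zero]) x a
      rw [hconst]
      exact h _ (by omega)
  funext x
  have := key (k + 1) le_rfl x
  rw [Nat.sub_self] at this
  have h2 := congrArg (fun T => T (fun i => i.elim0)) this
  simpa using h2

/-- The derivative of order `j` at `a` of a polynomial function. -/
noncomputable def polyFun.jet (E F : Type) [NormedAddCommGroup E] [NormedSpace ℝ E]
    [NormedAddCommGroup F] [NormedSpace ℝ F] (k j : ℕ) (a : E) :
    polyFun E F k →ₗ[ℝ] (ContinuousMultilinearMap ℝ (fun _ : Fin j => E) F) where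
  toFun Q := iteratedFDeriv ℝ j (Q : E → F) a
  map_add' P Q := iteratedFDeriv_add_apply (polyFun.contDiff P.2 (n := j)).contDiffAt
    (polyFun.contDiff Q.2 (n := j)).contDiffAt
  map_smul' _ Q := iteratedFDeriv_const_smul_apply (polyFun.contDiff Q.2 (n := j)).contDiffAt

/-- The jet up to order `k` at the origin embeds the space into a finite product of
finite-dimensional spaces of multilinear maps. -/
instance [FiniteDimensional ℝ E] [FiniteDimensional ℝ F] (k : ℕ) :
    FiniteDimensional ℝ (polyFun E F k) := by
  have hi : ∀ j : Fin (k + 1),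
      FiniteDimensional ℝ (ContinuousMultilinearMap ℝ (fun _ : Fin j => E) F) := fun j =>
    FiniteDimensional.of_injective
      (ContinuousMultilinearMap.toMultilinearMapLinear :
        ContinuousMultilinearMap ℝ (fun _ : Fin j => E) F →ₗ[ℝ] _)
      ContinuousMultilinearMap.toMultilinearMap_injective
  refine FiniteDimensional.of_injective
    (LinearMap.pi fun j : Fin (k + 1) => polyFun.jet E F k j 0) ?_
  rw [← LinearMap.ker_eq_bot, LinearMap.ker_eq_bot']
  intro Q hQ
  refine Subtype.ext (polyFun.eq_zero_of_jet Q.2 0 fun j hj => ?_)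
  exact congrFun hQ (⟨j, by omega⟩ : Fin (k + 1))

/-- The restriction of a polynomial function to the closed unit ball. -/
noncomputable def polyFun.restrict (E F : Type) [NormedAddCommGroup E] [NormedSpace ℝ E]
    [NormedAddCommGroup F] [NormedSpace ℝ F] (k : ℕ) :
    polyFun E F k →ₗ[ℝ] C(Metric.closedBall (0 : E) 1, F) where
  toFun Q := ⟨fun x => (Q : E → F) x, Q.2.1.continuous.comp continuous_subtype_val⟩
  map_add' _ _ := rfl
  map_smul' _ _ := rfl

theorem polyFun.restrict_injective (k : ℕ) :
    Function.Injective (polyFun.restrict E F k) := by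
  rw [← LinearMap.ker_eq_bot, LinearMap.ker_eq_bot']
  intro Q hQ
  refine Subtype.ext (polyFun.eq_zero_of_jet Q.2 0 fun j hj => ?_)
  have : (Q : E → F) =ᶠ[𝓝 0] fun _ => 0 := by
    filter_upwards [Metric.closedBall_mem_nhds (0 : E) one_pos] with x hx
    exact DFunLike.congr_fun hQ (⟨x, hx⟩ : Metric.closedBall (0 : E) 1)
  have h2 := (this.iteratedFDeriv ℝ j).eq_of_nhds
  rw [h2]
  simp

/-- Every linear map on polynomial functions is bounded by the supremum over the unit ball. -/
theorem polyFun.exists_norm_le [FiniteDimensional ℝ E] [FiniteDimensional ℝ F] (k : ℕ)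
    {G : Type*} [NormedAddCommGroup G] [NormedSpace ℝ G] (Λ : polyFun E F k →ₗ[ℝ] G) :
    ∃ C > 0, ∀ Q : polyFun E F k, ∀ M, 0 ≤ M →
      (∀ x ∈ Metric.closedBall (0 : E) 1, ‖(Q : E → F) x‖ ≤ M) → ‖Λ Q‖ ≤ C * M := by
  -- Restriction to the ball identifies the polynomials with a finite-dimensional normed space, on
  -- which every linear map is continuous.
  let e := LinearEquiv.ofInjective (polyFun.restrict E F k) (polyFun.restrict_injective k)
  have : FiniteDimensional ℝ (LinearMap.range (polyFun.restrict E F k)) := inferInstance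
  let Ψ : LinearMap.range (polyFun.restrict E F k) →L[ℝ] G :=
    LinearMap.toContinuousLinearMap (Λ ∘ₗ e.symm.toLinearMap)
  refine ⟨‖Ψ‖ + 1, by positivity, fun Q M hM hQ => ?_⟩
  have h1 : Λ Q = Ψ (e Q) := by simp [Ψ]
  have h2 : ‖e Q‖ ≤ M := by
    change ‖polyFun.restrict E F k Q‖ ≤ M
    rw [ContinuousMap.norm_le _ hM]
    exact fun x => hQ x x.2
  rw [h1]
  refine (Ψ.le_opNorm _).trans ?_
  have := norm_nonneg (e Q)
  nlinarith [norm_nonneg Ψ]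

theorem polyFun.comp_affine {k : ℕ} {Q : E → F} (hQ : Q ∈ polyFun E F k) (x : E) (ρ : ℝ) :
    (fun z => Q (x + ρ • z)) ∈ polyFun E F k := by
  have h1 : ContDiff ℝ (⊤ : ℕ∞) fun z => Q (x + z) := hQ.1.comp (contDiff_const.add contDiff_id)
  refine ⟨hQ.1.comp (contDiff_const.add (contDiff_const.smul contDiff_id)), fun z => ?_⟩
  rw [iteratedFDeriv_comp_const_smul (f := fun z => Q (x + z)) ρ
    (h1.of_le (by exact_mod_cast le_top))]
  simp only
  rw [iteratedFDeriv_comp_add_left, hQ.2, smul_zero]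

/-- A polynomial function which is small on a sufficiently dense subset of a ball has small
derivatives at the center. -/
theorem polyFun.exists_norm_iteratedFDeriv_le [FiniteDimensional ℝ E] [FiniteDimensional ℝ F]
    (k : ℕ) :
    ∃ δ > 0, ∃ C > 0, ∀ Q ∈ polyFun E F k, ∀ (x : E) (ρ t : ℝ) (S : Set E), 0 < ρ → 0 ≤ t →
      (∀ y ∈ Metric.closedBall x ρ, ∃ z ∈ S, z ∈ Metric.closedBall x ρ ∧ dist y z ≤ δ * ρ) →
      (∀ z ∈ S, ‖Q z‖ ≤ t) → ∀ j ≤ k, ‖iteratedFDeriv ℝ j Q x‖ * ρ ^ j ≤ C * t := by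
  let Λ : polyFun E F k →ₗ[ℝ] C(Metric.closedBall (0 : E) 1, E →L[ℝ] F) :=
    { toFun := fun Q => ⟨fun x => fderiv ℝ (Q : E → F) x,
        (Q.2.1.continuous_fderiv (by simp)).comp continuous_subtype_val⟩
      map_add' := fun P Q => by
        ext1 x
        exact fderiv_add (P.2.1.differentiable (by simp) _) (Q.2.1.differentiable (by simp) _)
      map_smul' := fun c Q => by
        ext1 x
        exact fderiv_const_smul (Q.2.1.differentiable (by simp) _) _ }
  obtain ⟨L, hL, hΛ⟩ := polyFun.exists_norm_le (E := E) (F := F) k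
    (G := C(Metric.closedBall (0 : E) 1, E →L[ℝ] F)) Λ
  choose C hC hCj using fun j => polyFun.exists_norm_le k (polyFun.jet E F k j 0)
  -- `L` bounds the gradient on the unit ball by the supremum of the polynomial. Moving by `1 / (2 *
  -- L)` therefore changes the value by at most half of that supremum.
  refine ⟨1 / (2 * L), by positivity, 2 * ∑ j ∈ Finset.range (k + 1), C j, ?_, ?_⟩
  · have : 0 < ∑ j ∈ Finset.range (k + 1), C j :=
      Finset.sum_pos (fun j _ => hC j) ⟨0, by simp⟩
    positivity
  intro Q hQ x ρ t S hρ ht hS hSt j hj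
  let R : polyFun E F k := ⟨fun z => Q (x + ρ • z), polyFun.comp_affine hQ x ρ⟩
  let M := ‖polyFun.restrict E F k R‖
  have hM : ∀ z ∈ Metric.closedBall (0 : E) 1, ‖(R : E → F) z‖ ≤ M := fun z hz =>
    (polyFun.restrict E F k R).norm_coe_le_norm ⟨z, hz⟩
  have hM0 : 0 ≤ M := norm_nonneg _
  have hfd : ∀ z ∈ Metric.closedBall (0 : E) 1, ‖fderiv ℝ (R : E → F) z‖ ≤ L * M := fun z hz =>
    ((Λ R).norm_coe_le_norm ⟨z, hz⟩).trans (hΛ R M hM0 hM)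
  -- The term `M / 2` is absorbed on the left, so the supremum `M` over the whole ball is at most `2
  -- * t`.
  have hle : M ≤ t + M / 2 := by
    refine (ContinuousMap.norm_le _ (by positivity)).2 fun y => ?_
    change ‖Q (x + ρ • (y : E))‖ ≤ _
    have hy : ‖(y : E)‖ ≤ 1 := mem_closedBall_zero_iff.1 y.2
    obtain ⟨z, hzS, hzb, hyz⟩ := hS (x + ρ • (y : E)) (by
      simp [norm_smul, abs_of_pos hρ]; nlinarith)
    have hz : x + ρ • (ρ⁻¹ • (z - x)) = z := by simp [smul_smul, hρ.ne']
    have hzb' : ρ⁻¹ • (z - x) ∈ Metric.closedBall (0 : E) 1 := by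
      simp only [Metric.mem_closedBall, dist_zero_right, norm_smul, norm_inv, Real.norm_eq_abs,
        abs_of_pos hρ]
      rw [Metric.mem_closedBall, dist_eq_norm] at hzb
      rw [inv_mul_le_iff₀ hρ]; simpa using hzb
    have hlip := (convex_closedBall (0 : E) 1).norm_image_sub_le_of_norm_fderiv_le
      (f := (R : E → F)) (fun w _ => R.2.1.differentiable (by simp) _) hfd hzb' y.2
    change ‖Q (x + ρ • (y : E)) - Q (x + ρ • (ρ⁻¹ • (z - x)))‖ ≤ _ at hlip
    rw [hz] at hlip
    have hd : ‖(y : E) - ρ⁻¹ • (z - x)‖ ≤ 1 / (2 * L) := by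
      have h3 : x + ρ • (y : E) - z = ρ • ((y : E) - ρ⁻¹ • (z - x)) := by
        rw [smul_sub, smul_smul, mul_inv_cancel₀ hρ.ne', one_smul]; abel
      rw [dist_eq_norm, h3, norm_smul, Real.norm_eq_abs, abs_of_pos hρ, mul_comm] at hyz
      exact le_of_mul_le_mul_right hyz hρ
    have h4 : L * M * ‖(y : E) - ρ⁻¹ • (z - x)‖ ≤ M / 2 := by
      calc _ ≤ L * M * (1 / (2 * L)) := by gcongr
        _ = M / 2 := by field_simp
    calc ‖Q (x + ρ • (y : E))‖ ≤ ‖Q z‖ + ‖Q (x + ρ • (y : E)) - Q z‖ := by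
          have := norm_add_le (Q z) (Q (x + ρ • (y : E)) - Q z)
          simpa using this
      _ ≤ t + M / 2 := add_le_add (hSt z hzS) (hlip.trans h4)
  have hj' : ‖iteratedFDeriv ℝ j (fun z => Q (x + ρ • z)) 0‖ ≤ C j * (2 * t) :=
    hCj j R (2 * t) (by positivity) fun z hz => (hM z hz).trans (by linarith)
  have h1 : ContDiff ℝ (⊤ : ℕ∞) fun z => Q (x + z) := hQ.1.comp (contDiff_const.add contDiff_id)
  rw [iteratedFDeriv_comp_const_smul (f := fun z => Q (x + z)) ρ
    (h1.of_le (by exact_mod_cast le_top))] at hj'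
  simp only [smul_zero, iteratedFDeriv_comp_add_left, add_zero, norm_smul, norm_pow,
    Real.norm_eq_abs, abs_of_pos hρ] at hj'
  have hCle : C j ≤ ∑ i ∈ Finset.range (k + 1), C i :=
    Finset.single_le_sum (fun i _ => (hC i).le) (by simp; omega)
  rw [mul_comm]
  nlinarith

theorem polyFun.mul_mem {k l : ℕ} {P : E → ℝ} {Q : E → F} (hP : P ∈ polyFun E ℝ k)
    (hQ : Q ∈ polyFun E F l) : (fun x => P x • Q x) ∈ polyFun E F (k + l) := by
  refine ⟨hP.1.smul hQ.1, fun x => ?_⟩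
  rw [← norm_le_zero_iff]
  refine (norm_iteratedFDeriv_smul_le (N := (⊤ : ℕ∞)) hP.1 hQ.1 x
    (by exact_mod_cast le_top)).trans (le_of_eq (Finset.sum_eq_zero fun i hi => ?_))
  rcases lt_or_ge k i with h | h
  · rw [iteratedFDeriv_eq_zero_of_le h hP.2]; simp
  · rw [iteratedFDeriv_eq_zero_of_le (i := l + 1) (by omega) hQ.2]; simp

theorem polyFun.mono {k l : ℕ} (h : k ≤ l) : polyFun E F k ≤ polyFun E F l := fun _ hQ =>
  ⟨hQ.1, iteratedFDeriv_eq_zero_of_le (by omega) hQ.2⟩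

end PolynomialFunctions

/-! ### Taylor monomials and the jet of a centered polynomial. -/

section TaylorMonomials

variable {n m : ℕ}

/-- The normalized monomial `(y - x)^β / β!`. -/
noncomputable def taylorMonomial (x : Rn n) (β : Fin n → ℕ) (y : Rn n) : ℝ :=
  ∏ i, (y i - x i) ^ β i / ((β i).factorial : ℝ)

theorem polyFun.const_mem {E F : Type} [NormedAddCommGroup E] [NormedSpace ℝ E]
    [NormedAddCommGroup F] [NormedSpace ℝ F] (k : ℕ) (c : F) : (fun _ => c) ∈ polyFun E F k :=
  ⟨contDiff_const, fun x => by
    simp [iteratedFDeriv_const_of_ne (𝕜 := ℝ) (Nat.succ_ne_zero k) c]⟩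

theorem polyFun.coord_sub_mem (x : Rn n) (i : Fin n) :
    (fun y : Rn n => y i - x i) ∈ polyFun (Rn n) ℝ 1 := by
  refine Submodule.sub_mem _ ?_ (polyFun.const_mem 1 (x i))
  refine ⟨(EuclideanSpace.proj (𝕜 := ℝ) i).contDiff, fun y => ?_⟩
  have h : fderiv ℝ (fun y : Rn n => y i) = fun _ => EuclideanSpace.proj (𝕜 := ℝ) i :=
    funext fun y => (EuclideanSpace.proj (𝕜 := ℝ) i).fderiv
  rw [← norm_eq_zero, ← norm_iteratedFDeriv_fderiv, h,
    iteratedFDeriv_const_of_ne (𝕜 := ℝ) one_ne_zero]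
  simp

theorem polyFun.pow_mem {E : Type} [NormedAddCommGroup E] [NormedSpace ℝ E] {P : E → ℝ}
    (hP : P ∈ polyFun E ℝ 1) (l : ℕ) : (fun y => P y ^ l) ∈ polyFun E ℝ l := by
  induction l with
  | zero => simpa using polyFun.const_mem 0 (1 : ℝ)
  | succ l ih => simpa only [pow_succ, smul_eq_mul] using polyFun.mul_mem ih hP

theorem taylorMonomial_mem (x : Rn n) (β : Fin n → ℕ) :
    taylorMonomial x β ∈ polyFun (Rn n) ℝ (∑ i, β i) := by
  have key : ∀ s : Finset (Fin n),
      (fun y : Rn n => ∏ i ∈ s, (y i - x i) ^ β i / ((β i).factorial : ℝ)) ∈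
        polyFun (Rn n) ℝ (∑ i ∈ s, β i) := by
    intro s
    induction s using Finset.induction_on with
    | empty => simpa using polyFun.const_mem 0 (1 : ℝ)
    | insert i s hi ih =>
      simp only [Finset.prod_insert hi, Finset.sum_insert hi]
      refine polyFun.mul_mem (P := fun y : Rn n => (y i - x i) ^ β i / ((β i).factorial : ℝ)) ?_ ih
      have := Submodule.smul_mem _ (((β i).factorial : ℝ)⁻¹)
        (polyFun.pow_mem (polyFun.coord_sub_mem x i) (β i))
      convert this using 1
      ext y
      simp [div_eq_inv_mul]
  exact key Finset.univ

theorem centeredPoly_eq_sum (k : ℕ) (c : (Fin n → ℕ) → Rn m) (x : Rn n) :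
    centeredPoly k c x = ∑ α ∈ multiIndices n k, fun y => taylorMonomial x α y • c α := by
  ext1 y
  simp [centeredPoly, taylorMonomial, Finset.prod_div_distrib]

theorem centeredPoly_mem (k : ℕ) (c : (Fin n → ℕ) → Rn m) (x : Rn n) :
    centeredPoly k c x ∈ polyFun (Rn n) (Rn m) k := by
  rw [centeredPoly_eq_sum]
  refine Submodule.sum_mem _ fun α hα => ?_
  exact polyFun.mono (by simpa using mem_multiIndices.1 hα)
    (polyFun.mul_mem (taylorMonomial_mem x α) (polyFun.const_mem 0 (c α)))

theorem fderiv_taylorMonomial_single (x : Rn n) (β : Fin n → ℕ) (i : Fin n) (y : Rn n) :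
    fderiv ℝ (taylorMonomial x β) y (EuclideanSpace.single i 1) =
      if β i = 0 then 0 else taylorMonomial x (Function.update β i (β i - 1)) y := by
  have hd : DifferentiableAt ℝ (taylorMonomial x β) y :=
    (taylorMonomial_mem x β).1.differentiable (by simp) y
  rw [← hd.lineDeriv_eq_fderiv]
  refine HasLineDerivAt.lineDeriv ?_
  have hfun : (fun t : ℝ => taylorMonomial x β (y + t • EuclideanSpace.single i (1 : ℝ))) =
      fun t => ((y i - x i) + t) ^ β i / ((β i).factorial : ℝ) *
        ∏ j ∈ Finset.univ.erase i, (y j - x j) ^ β j / ((β j).factorial : ℝ) := by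
    ext t
    rw [taylorMonomial, ← Finset.mul_prod_erase _ _ (Finset.mem_univ i)]
    congr 1
    · simp [add_sub_right_comm]
    · refine Finset.prod_congr rfl fun j hj => ?_
      simp [Finset.ne_of_mem_erase hj]
  unfold HasLineDerivAt
  rw [hfun]
  have h1 : HasDerivAt (fun t : ℝ => ((y i - x i) + t) ^ β i / ((β i).factorial : ℝ))
      (β i * (y i - x i) ^ (β i - 1) / ((β i).factorial : ℝ)) 0 := by
    have := ((((hasDerivAt_id (0 : ℝ)).const_add (y i - x i)).pow (β i)).div_const
      ((β i).factorial : ℝ))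
    simpa using this
  refine (h1.mul_const _).congr_deriv ?_
  split_ifs with h
  · simp [h]
  · rw [taylorMonomial, ← Finset.mul_prod_erase _ _ (Finset.mem_univ i)]
    congr 1
    · obtain ⟨b, hb⟩ := Nat.exists_eq_succ_of_ne_zero h
      simp only [hb, Function.update_self, Nat.succ_eq_add_one, Nat.add_sub_cancel,
        Nat.factorial_succ]
      push_cast
      field_simp
    · refine Finset.prod_congr rfl fun j hj => ?_
      simp [Finset.ne_of_mem_erase hj]

/-- Peeling off the last direction lowers one exponent by one, or gives zero if that exponent is
already used up. At the center a monomial is nonzero only when all exponents have reached zero. -/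
theorem iteratedFDeriv_taylorMonomial_self (x : Rn n) (N : ℕ) (β : Fin n → ℕ)
    (j : Fin N → Fin n) :
    iteratedFDeriv ℝ N (taylorMonomial x β) x (fun t => EuclideanSpace.single (j t) (1 : ℝ)) =
      if ∀ i, (∑ t, if j t = i then 1 else 0) = β i then 1 else 0 := by
  induction N generalizing β with
  | zero =>
    simp only [iteratedFDeriv_zero_apply, Finset.univ_eq_empty, Finset.sum_empty]
    split_ifs with h
    · exact Finset.prod_eq_one fun i _ => by simp [← h i]
    · push Not at h
      obtain ⟨i, hi⟩ := h
      exact Finset.prod_eq_zero (Finset.mem_univ i) (by simp [hi.symm])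
  | succ N ih =>
    rw [iteratedFDeriv_succ_apply_right]
    have hc : ContDiff ℝ N (fun y => fderiv ℝ (taylorMonomial x β) y) :=
      (polyFun.contDiff (taylorMonomial_mem x β) (n := (N + 1 : ℕ))).fderiv_right (by simp)
    rw [← iteratedFDeriv_clm_apply_const_apply hc le_rfl]
    simp only [fderiv_taylorMonomial_single, Fin.sum_univ_castSucc]
    by_cases h : β (j (Fin.last N)) = 0
    · simp only [h, if_true]
      rw [if_neg]
      · simp
      · intro h'
        have := h' (j (Fin.last N))
        simp [h] at this
    · simp only [h, if_false]
      have := ih (Function.update β (j (Fin.last N)) (β (j (Fin.last N)) - 1))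
        (fun t => j t.castSucc)
      refine Eq.trans this ?_
      congr 1
      refine propext (forall_congr' fun i => ?_)
      by_cases hi : j (Fin.last N) = i
      · subst hi
        simp only [Function.update_self, if_true]
        omega
      · simp [Function.update_of_ne (Ne.symm hi), hi]

/-- The coefficients of a polynomial are its partial derivatives at the center. -/
theorem multiDeriv_centeredPoly (k : ℕ) (c : (Fin n → ℕ) → Rn m) (x : Rn n) {α : Fin n → ℕ}
    (hα : ∑ i, α i ≤ k) : multiDeriv α (centeredPoly k c x) x = c α := by
  -- The enumeration of directions in `multiDeriv` lists each `i` exactly `α i` times.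
  have hcount : ∀ i, (∑ t : Fin (∑ i, α i), if (finSigmaFinEquiv.symm t).1 = i then 1 else 0)
      = α i := by
    intro i
    rw [Equiv.sum_comp finSigmaFinEquiv.symm
      (fun p : (i : Fin n) × Fin (α i) => if p.1 = i then 1 else 0),
      Fintype.sum_sigma]
    simp [apply_ite Finset.card]
  have hterm : ∀ β : Fin n → ℕ, ∀ v, iteratedFDeriv ℝ (∑ i, α i)
      (fun y => taylorMonomial x β y • c β) x v =
        iteratedFDeriv ℝ (∑ i, α i) (taylorMonomial x β) x v • c β := by
    intro β v
    have h := ((1 : ℝ →L[ℝ] ℝ).smulRight (c β)).iteratedFDeriv_comp_left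
      (f := taylorMonomial x β) (x := x) (i := ∑ i, α i) (n := ((∑ i, α i : ℕ) : ℕ∞))
      (polyFun.contDiff (taylorMonomial_mem x β)).contDiffAt (by simp)
    exact congrArg (fun T => T v) h
  have hsmooth : ∀ β ∈ multiIndices n k,
      ContDiff ℝ ((∑ i, α i : ℕ) : ℕ∞) fun y => taylorMonomial x β y • c β := fun β _ =>
    (polyFun.contDiff (taylorMonomial_mem x β)).smul contDiff_const
  rw [multiDeriv, centeredPoly_eq_sum]
  have h := iteratedFDeriv_sum (𝕜 := ℝ) (i := ∑ i, α i) hsmooth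
  rw [show (∑ β ∈ multiIndices n k, fun y => taylorMonomial x β y • c β) =
    fun y => ∑ β ∈ multiIndices n k, taylorMonomial x β y • c β from by ext1 y; simp]
  rw [h]
  simp only [Finset.sum_apply, sum_apply, hterm,
    iteratedFDeriv_taylorMonomial_self, hcount]
  rw [Finset.sum_eq_single α]
  · simp
  · intro β _ hβ
    rw [if_neg, zero_smul]
    exact fun h => hβ (funext fun i => (h i).symm)
  · exact fun h => absurd (mem_multiIndices.2 hα) h

end TaylorMonomials

/-! ### Mollified indicator functions. -/

section Mollification

variable {E F : Type} [NormedAddCommGroup E] [MeasurableSpace E]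
  [NormedAddCommGroup F] [NormedSpace ℝ F]

/-- The convolution of `φ` with the indicator function of `V`. -/
noncomputable def indicatorConv (μ : Measure E) (φ : E → F) (V : Set E) (x : E) : F :=
  ∫ y in V, φ (x - y) ∂μ

theorem indicatorConv_eq_convolution (μ : Measure E) (φ : E → F)
    {V : Set E} (hV : MeasurableSet V) :
    indicatorConv μ φ V =
      convolution (V.indicator fun _ => (1 : ℝ)) φ (ContinuousLinearMap.lsmul ℝ ℝ) μ := by
  ext1 x
  rw [indicatorConv, ← integral_indicator hV, convolution]
  congr 1
  ext1 y
  by_cases hy : y ∈ V <;> simp [hy]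

theorem locallyIntegrable_indicator_one (μ : Measure E)
    [IsLocallyFiniteMeasure μ] {V : Set E} (hV : MeasurableSet V) :
    LocallyIntegrable (V.indicator fun _ => (1 : ℝ)) μ :=
  (locallyIntegrable_const (1 : ℝ)).indicator hV

variable [NormedSpace ℝ E] [BorelSpace E]

theorem measurableSet_smul_mem (r : ℝ) {V : Set E} (hV : MeasurableSet V) :
    MeasurableSet {y | r • y ∈ V} := measurable_const_smul r hV

variable [FiniteDimensional ℝ E] (μ : Measure E) [μ.IsAddHaarMeasure]

theorem contDiff_indicatorConv {φ : E → F} (hφ : ContDiff ℝ (⊤ : ℕ∞) φ) (hc : HasCompactSupport φ)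
    {V : Set E} (hV : MeasurableSet V) : ContDiff ℝ (⊤ : ℕ∞) (indicatorConv μ φ V) := by
  rw [indicatorConv_eq_convolution μ φ hV]
  exact hc.contDiff_convolution_right _ (locallyIntegrable_indicator_one μ hV) hφ

theorem fderiv_indicatorConv {φ : E → F} (hφ : ContDiff ℝ (⊤ : ℕ∞) φ) (hc : HasCompactSupport φ)
    {V : Set E} (hV : MeasurableSet V) :
    fderiv ℝ (indicatorConv μ φ V) = indicatorConv μ (fderiv ℝ φ) V := by
  ext1 x
  rw [indicatorConv_eq_convolution μ φ hV, indicatorConv_eq_convolution μ (fderiv ℝ φ) hV]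
  rw [(hc.hasFDerivAt_convolution_right _ (locallyIntegrable_indicator_one μ hV)
    (hφ.of_le (by exact_mod_cast le_top)) x).fderiv]
  rw [convolution, convolution]
  congr 1

/-- Derivatives fall on the bump, and integrals over disjoint pieces add up to at most the integral
over the space. The bound thus does not depend on the number or shape of the pieces. -/
theorem sum_norm_iteratedFDeriv_indicatorConv_le {ι : Type*} (T : Finset ι) (V : ι → Set E)
    (hV : ∀ b ∈ T, MeasurableSet (V b)) (hd : Set.Pairwise (T : Set ι) (Function.onFun Disjoint V))
    (j : ℕ) {φ : E → F} (hφ : ContDiff ℝ (⊤ : ℕ∞) φ) (hc : HasCompactSupport φ) (x : E) :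
    ∑ b ∈ T, ‖iteratedFDeriv ℝ j (indicatorConv μ φ (V b)) x‖ ≤
      ∫ y, ‖iteratedFDeriv ℝ j φ y‖ ∂μ := by
  induction j generalizing F with
  | zero =>
    simp only [norm_iteratedFDeriv_zero]
    have hint : Integrable (fun y => ‖φ (x - y)‖) μ :=
      ((hφ.continuous.integrable_of_hasCompactSupport hc).comp_sub_left x).norm
    calc ∑ b ∈ T, ‖indicatorConv μ φ (V b) x‖
        ≤ ∑ b ∈ T, ∫ y in V b, ‖φ (x - y)‖ ∂μ :=
          Finset.sum_le_sum fun b _ => norm_integral_le_integral_norm _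
      _ = ∫ y in ⋃ b ∈ T, V b, ‖φ (x - y)‖ ∂μ :=
          (integral_biUnion_finset T hV hd fun b _ => hint.integrableOn).symm
      _ ≤ ∫ y, ‖φ (x - y)‖ ∂μ :=
          setIntegral_le_integral hint (Eventually.of_forall fun _ => norm_nonneg _)
      _ = ∫ y, ‖φ y‖ ∂μ := integral_sub_left_eq_self (fun y => ‖φ y‖) μ x
  | succ j ih =>
    have h := ih (hφ.fderiv_right (m := (⊤ : ℕ∞)) (by simp)) (hc.fderiv ℝ)
    simp only [norm_iteratedFDeriv_fderiv] at h
    refine le_trans (Finset.sum_le_sum fun b hb => ?_) h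
    rw [← norm_iteratedFDeriv_fderiv, fderiv_indicatorConv μ hφ hc (hV b hb)]

/-- A smooth bump function supported in the unit ball. -/
noncomputable def unitBump (E : Type) [NormedAddCommGroup E] [NormedSpace ℝ E]
    [FiniteDimensional ℝ E] : ContDiffBump (0 : E) := ⟨1 / 2, 1, by norm_num, by norm_num⟩

/-- The indicator function of `V`, mollified at scale `r`. -/
noncomputable def smoothIndicator (r : ℝ) (V : Set E) (x : E) : ℝ :=
  indicatorConv Measure.addHaar ((unitBump E).normed Measure.addHaar) {y | r • y ∈ V} (r⁻¹ • x)

theorem contDiff_smoothIndicator (r : ℝ) {V : Set E} (hV : MeasurableSet V) :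
    ContDiff ℝ (⊤ : ℕ∞) (smoothIndicator r V) :=
  (contDiff_indicatorConv _ (unitBump E).contDiff_normed (unitBump E).hasCompactSupport_normed
    (measurableSet_smul_mem r hV)).comp (contDiff_const_smul _)

/-- Rescaling by `r⁻¹` contributes `r⁻ʲ` to the derivative of order `j` and reduces to the unit
scale. -/
theorem exists_sum_norm_iteratedFDeriv_smoothIndicator_le (E : Type) [NormedAddCommGroup E]
    [NormedSpace ℝ E] [FiniteDimensional ℝ E] [MeasurableSpace E] [BorelSpace E] (k : ℕ) :
    ∃ C > 0, ∀ {ι : Type} (T : Finset ι) (V : ι → Set E),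
      (∀ b ∈ T, MeasurableSet (V b)) → Set.Pairwise (T : Set ι) (Function.onFun Disjoint V) →
      ∀ j ≤ k, ∀ r > 0, ∀ x,
        (∑ b ∈ T, ‖iteratedFDeriv ℝ j (smoothIndicator r (V b)) x‖) * r ^ j ≤ C := by
  let I : ℕ → ℝ := fun j =>
    ∫ y, ‖iteratedFDeriv ℝ j ((unitBump E).normed Measure.addHaar) y‖ ∂Measure.addHaar
  have hI : ∀ j, 0 ≤ I j := fun j => integral_nonneg fun _ => norm_nonneg _
  refine ⟨∑ j ∈ Finset.range (k + 1), I j + 1, by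
    have := Finset.sum_nonneg fun j (_ : j ∈ Finset.range (k + 1)) => hI j
    linarith, fun {ι} T V hV hd j hj r hr x => ?_⟩
  have h1 : ∀ b ∈ T, ‖iteratedFDeriv ℝ j (smoothIndicator r (V b)) x‖ * r ^ j =
      ‖iteratedFDeriv ℝ j (indicatorConv (Measure.addHaar : Measure E)
        ((unitBump E).normed Measure.addHaar) {y | r • y ∈ V b}) (r⁻¹ • x)‖ := by
    intro b hb
    have := congrFun (iteratedFDeriv_comp_const_smul (i := j) r⁻¹
      ((contDiff_indicatorConv (Measure.addHaar : Measure E)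
        (φ := (unitBump E).normed Measure.addHaar) (unitBump E).contDiff_normed
        (unitBump E).hasCompactSupport_normed (measurableSet_smul_mem r (hV b hb))).of_le
        (natCast_le_smooth j))) x
    change iteratedFDeriv ℝ j (smoothIndicator r (V b)) x = _ at this
    rw [this, norm_smul, norm_pow, norm_inv, Real.norm_eq_abs, abs_of_pos hr, mul_right_comm,
      ← mul_pow, inv_mul_cancel₀ hr.ne', one_pow, one_mul]
  rw [Finset.sum_mul, Finset.sum_congr rfl h1]
  refine (sum_norm_iteratedFDeriv_indicatorConv_le Measure.addHaar T (fun b => {y | r • y ∈ V b})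
    (fun b hb => measurableSet_smul_mem r (hV b hb)) ?_ j
    (φ := (unitBump E).normed Measure.addHaar) (unitBump E).contDiff_normed
    (unitBump E).hasCompactSupport_normed _).trans ?_
  · intro b hb c hc hbc
    exact (hd hb hc hbc).preimage (fun y => r • y)
  · have := Finset.single_le_sum (f := I) (fun i _ => hI i)
      (Finset.mem_range.2 (Nat.lt_succ_of_le hj))
    change I j ≤ _
    linarith

theorem sum_smoothIndicator {ι : Type*} (T : Finset ι) (V : ι → Set E)
    (hV : ∀ b ∈ T, MeasurableSet (V b)) (hd : Set.Pairwise (T : Set ι) (Function.onFun Disjoint V))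
    (hcov : ∀ y, ∃ b ∈ T, y ∈ V b) (r : ℝ) (x : E) :
    ∑ b ∈ T, smoothIndicator r (V b) x = 1 := by
  have hint : Integrable (fun y => (unitBump E).normed Measure.addHaar (r⁻¹ • x - y))
      Measure.addHaar :=
    ((unitBump E).continuous_normed.integrable_of_hasCompactSupport
      (unitBump E).hasCompactSupport_normed).comp_sub_left _
  have hU : (⋃ b ∈ T, {y : E | r • y ∈ V b}) = Set.univ := by
    ext y
    simpa using hcov (r • y)
  unfold smoothIndicator indicatorConv
  rw [← integral_biUnion_finset T (fun b hb => measurableSet_smul_mem r (hV b hb))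
    (fun b hb c hc hbc => (hd hb hc hbc).preimage (fun y => r • y))
    fun b _ => hint.integrableOn, hU, setIntegral_univ,
    integral_sub_left_eq_self (fun y => (unitBump E).normed Measure.addHaar y)]
  exact (unitBump E).integral_normed

theorem smoothIndicator_eq_zero {r : ℝ} (hr : 0 < r) {V : Set E} (x : E)
    (h : Disjoint (Metric.ball x r) V) : smoothIndicator r V x = 0 := by
  refine setIntegral_eq_zero_of_forall_eq_zero fun y hy => ?_
  have hy' : r • y ∉ Metric.ball x r := fun h' => Set.disjoint_left.1 h h' hy
  rw [← Function.notMem_support, (unitBump E).support_normed_eq]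
  rw [Metric.mem_ball, dist_eq_norm] at hy' ⊢
  intro h2
  apply hy'
  have h3 : r • y - x = (-r) • (r⁻¹ • x - y - 0) := by
    rw [sub_zero, smul_sub, smul_smul, neg_mul, mul_inv_cancel₀ hr.ne']
    simp only [neg_smul, one_smul]; abel
  rw [h3, norm_smul, norm_neg, Real.norm_eq_abs, abs_of_pos hr]
  have : (unitBump E).rOut = 1 := rfl
  rw [this] at h2
  nlinarith

theorem smoothIndicator_eventuallyEq_zero {r ρ : ℝ} (hr : 0 < r) (hρ : r < ρ) {V : Set E} {x : E}
    (h : Disjoint (Metric.ball x ρ) V) : smoothIndicator r V =ᶠ[𝓝 x] fun _ => 0 := by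
  filter_upwards [Metric.ball_mem_nhds x (sub_pos.2 hρ)] with z hz
  refine smoothIndicator_eq_zero hr z (h.mono_left ?_)
  exact Metric.ball_subset_ball' (by rw [Metric.mem_ball] at hz; linarith)

theorem smoothIndicator_eventuallyEq_one {r ρ : ℝ} (hr : 0 < r) (hρ : r < ρ) {V : Set E}
    (hV : MeasurableSet V) {x : E} (h : Metric.ball x ρ ⊆ V) :
    smoothIndicator r V =ᶠ[𝓝 x] fun _ => 1 := by
  filter_upwards [smoothIndicator_eventuallyEq_zero (V := Vᶜ) hr hρ
    (Set.disjoint_compl_right_iff_subset.2 h)] with z hz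
  -- `V` and its complement form a two-piece partition, and the mollified complement already
  -- vanishes near `x`.
  have := sum_smoothIndicator (Finset.univ : Finset Bool) (fun b => cond b V Vᶜ)
    (by simp [hV, hV.compl])
    (by intro b _ c _ hbc
        cases b <;> cases c <;>
          simp [Function.onFun, disjoint_compl_left, disjoint_compl_right] at hbc ⊢)
    (fun y => by by_cases hy : y ∈ V <;> simp [hy]) r z
  simpa [hz] using this

end Mollification

/-! ### A Whitney-type partition of unity off a compact set. -/

section WhitneyPartition

variable {E : Type} [NormedAddCommGroup E] [NormedSpace ℝ E] [FiniteDimensional ℝ E]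
  [MeasurableSpace E] [BorelSpace E]

/-- A finite measurable partition of the space, indexed by points of the compact set `K`, each piece
of which consists of points almost nearest to its index. -/
theorem IsCompact.exists_nearest_partition {E : Type} [NormedAddCommGroup E] [MeasurableSpace E]
    [BorelSpace E] {K : Set E} (hK : IsCompact K) (hne : K.Nonempty) {r : ℝ} (hr : 0 < r) :
    ∃ (T : Finset E) (V : E → Set E), (∀ b ∈ T, b ∈ K) ∧ (∀ b ∈ T, MeasurableSet (V b)) ∧
      Set.Pairwise (T : Set E) (Function.onFun Disjoint V) ∧ (∀ y, ∃ b ∈ T, y ∈ V b) ∧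
      ∀ b ∈ T, ∀ y ∈ V b, dist y b ≤ Metric.infDist y K + r := by
  have : Nonempty K := hne.to_subtype
  obtain ⟨t, htK, htf, htc⟩ := hK.finite_cover_balls hr
  have htne : t.Nonempty := by
    obtain ⟨a, ha⟩ := hne
    obtain ⟨b, hb, -⟩ := Set.mem_iUnion₂.1 (htc ha)
    exact ⟨b, hb⟩
  obtain ⟨e, he⟩ := htf.countable.exists_eq_range htne
  obtain ⟨N, hN⟩ : ∃ N, ∀ b ∈ t, ∃ i ≤ N, e i = b := by
    choose! i hi using fun b (hb : b ∈ t) => (he ▸ hb : b ∈ Set.range e)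
    refine ⟨htf.toFinset.sup i, fun b hb => ⟨i b, ?_, hi b hb⟩⟩
    exact Finset.le_sup (htf.mem_toFinset.2 hb)
  -- The fibers of a simple nearest-point map onto a finite `r`-net are automatically measurable and
  -- disjoint; using a net instead of `K` costs the extra `r`.
  let p := SimpleFunc.nearestPt e N
  have hpK : ∀ y, p y ∈ K := fun y => htK (by rw [he]; exact ⟨_, rfl⟩)
  refine ⟨p.range, fun b => p ⁻¹' {b}, ?_, fun b _ => p.measurableSet_fiber b, ?_, ?_, ?_⟩
  · intro b hb
    obtain ⟨y, rfl⟩ := SimpleFunc.mem_range.1 hb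
    exact hpK y
  · intro b _ c _ hbc
    exact Disjoint.preimage _ (Set.disjoint_singleton.2 hbc)
  · exact fun y => ⟨p y, SimpleFunc.mem_range_self p y, rfl⟩
  · rintro b - y rfl
    obtain ⟨a, ha, had⟩ := hK.exists_infDist_eq_dist hne y
    obtain ⟨c, hc, hac⟩ := Set.mem_iUnion₂.1 (htc ha)
    obtain ⟨i, hi, rfl⟩ := hN c hc
    have h1 : dist (p y) y ≤ dist (e i) y := by
      have := SimpleFunc.edist_nearestPt_le e y hi
      rwa [edist_dist, edist_dist, ENNReal.ofReal_le_ofReal_iff dist_nonneg] at this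
    rw [Metric.mem_ball] at hac
    rw [had, dist_comm y (p y)]
    have := dist_triangle (e i) a y
    rw [dist_comm (e i) a, dist_comm a y] at this
    linarith

/-- A smooth function equal to `1` near the points at distance less than `2⁻ⁱ` from `K` and to `0`
at distance more than `3 · 2⁻ⁱ`. -/
noncomputable def dyadicCutoff (K : Set E) (i : ℕ) : E → ℝ :=
  smoothIndicator ((2 : ℝ)⁻¹ ^ i) {y | Metric.infDist y K < 2 * (2 : ℝ)⁻¹ ^ i}

/-- The difference of two consecutive cutoffs, which selects the points at distance about `2⁻ⁱ`
from `K`. -/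
noncomputable def dyadicShell (K : Set E) (i : ℕ) (x : E) : ℝ :=
  dyadicCutoff K i x - dyadicCutoff K (i + 1) x

theorem measurableSet_infDist_lt {E : Type} [NormedAddCommGroup E] [MeasurableSpace E]
    [BorelSpace E] (K : Set E) (r : ℝ) :
    MeasurableSet {y | Metric.infDist y K < r} :=
  (isOpen_lt (Metric.continuous_infDist_pt K) continuous_const).measurableSet

theorem contDiff_dyadicCutoff (K : Set E) (i : ℕ) : ContDiff ℝ (⊤ : ℕ∞) (dyadicCutoff K i) :=
  contDiff_smoothIndicator _ (measurableSet_infDist_lt K _)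

theorem contDiff_dyadicShell (K : Set E) (i : ℕ) : ContDiff ℝ (⊤ : ℕ∞) (dyadicShell K i) :=
  (contDiff_dyadicCutoff K i).sub (contDiff_dyadicCutoff K (i + 1))

theorem dyadicCutoff_eventuallyEq_one {K : Set E} {i : ℕ} {x : E}
    (h : Metric.infDist x K < (2 : ℝ)⁻¹ ^ i) : dyadicCutoff K i =ᶠ[𝓝 x] fun _ => 1 := by
  refine smoothIndicator_eventuallyEq_one (ρ := 2 * (2 : ℝ)⁻¹ ^ i - Metric.infDist x K)
    (by positivity) (by linarith) (measurableSet_infDist_lt K _) fun y hy => ?_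
  have := Metric.infDist_le_infDist_add_dist (s := K) (x := y) (y := x)
  rw [Metric.mem_ball] at hy
  change Metric.infDist y K < _
  linarith

theorem dyadicCutoff_eq_zero {K : Set E} {i : ℕ} {x : E}
    (h : 3 * (2 : ℝ)⁻¹ ^ i < Metric.infDist x K) : dyadicCutoff K i x = 0 := by
  refine smoothIndicator_eq_zero (by positivity) x (Set.disjoint_left.2 fun y hy hy' => ?_)
  have := Metric.infDist_le_infDist_add_dist (s := K) (x := x) (y := y)
  rw [Metric.mem_ball, dist_comm] at hy
  change Metric.infDist y K < _ at hy'
  linarith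

theorem eventually_lt_infDist {E : Type} [NormedAddCommGroup E] {K : Set E} {x : E} {r : ℝ}
    (h : r < Metric.infDist x K) :
    ∀ᶠ z in 𝓝 x, r < Metric.infDist z K :=
  (Metric.continuous_infDist_pt K).continuousAt.eventually (lt_mem_nhds h)

theorem dyadicShell_eq_zero {K : Set E} {i : ℕ} {x : E}
    (h : 3 * (2 : ℝ)⁻¹ ^ i < Metric.infDist x K) : dyadicShell K i x = 0 := by
  have : (2 : ℝ)⁻¹ ^ (i + 1) ≤ (2 : ℝ)⁻¹ ^ i :=
    pow_le_pow_of_le_one (by norm_num) (by norm_num) (Nat.le_succ i)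
  rw [dyadicShell, dyadicCutoff_eq_zero h, dyadicCutoff_eq_zero (by linarith), sub_zero]

theorem dyadicShell_eventuallyEq_zero {K : Set E} {i : ℕ} {x : E}
    (h : 3 * (2 : ℝ)⁻¹ ^ i < Metric.infDist x K ∨ 2 * Metric.infDist x K < (2 : ℝ)⁻¹ ^ i) :
    dyadicShell K i =ᶠ[𝓝 x] fun _ => 0 := by
  rcases h with h | h
  · filter_upwards [eventually_lt_infDist h] with z hz using dyadicShell_eq_zero hz
  · have h0 : 0 ≤ Metric.infDist x K := Metric.infDist_nonneg
    filter_upwards [dyadicCutoff_eventuallyEq_one (K := K) (i := i) (x := x) (by linarith),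
      dyadicCutoff_eventuallyEq_one (K := K) (i := i + 1) (x := x) (by
        rw [pow_succ]; linarith)] with z h1 h2
    rw [dyadicShell, h1, h2, sub_self]

theorem sum_dyadicShell_eventuallyEq_one {K : Set E} {N : ℕ} {x : E}
    (h1 : Metric.infDist x K < 1) (hN : 3 * (2 : ℝ)⁻¹ ^ N < Metric.infDist x K) :
    ∀ᶠ z in 𝓝 x, ∑ i ∈ Finset.range N, dyadicShell K i z = 1 := by
  filter_upwards [dyadicCutoff_eventuallyEq_one (K := K) (i := 0) (x := x) (by simpa using h1),
    eventually_lt_infDist hN] with z hz hz'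
  simp only [dyadicShell]
  rw [Finset.sum_range_sub' (fun i => dyadicCutoff K i z), hz, dyadicCutoff_eq_zero hz', sub_zero]

theorem iteratedFDeriv_eq_zero_of_eventuallyEq {E F : Type} [NormedAddCommGroup E]
    [NormedSpace ℝ E] [NormedAddCommGroup F] [NormedSpace ℝ F] {f : E → F} {x : E}
    (h : f =ᶠ[𝓝 x] fun _ => 0) (j : ℕ) : iteratedFDeriv ℝ j f x = 0 := by
  rw [(h.iteratedFDeriv ℝ j).eq_of_nhds]
  simp

/-- The admissible powers lie in `[d/3, 2d]`. The endpoints have ratio `6 < 2³`, so two admissible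
indices differ by at most two. -/
theorem card_dyadic_le {d : ℝ} (N : ℕ) :
    ((Finset.range N).filter fun i => d ≤ 3 * (2 : ℝ)⁻¹ ^ i ∧ (2 : ℝ)⁻¹ ^ i ≤ 2 * d).card ≤ 3 := by
  set S := (Finset.range N).filter fun i => d ≤ 3 * (2 : ℝ)⁻¹ ^ i ∧ (2 : ℝ)⁻¹ ^ i ≤ 2 * d with hS
  rcases S.eq_empty_or_nonempty with h | h
  · simp [h]
  have hsub : S ⊆ Finset.Icc (S.min' h) (S.min' h + 2) := by
    intro i hi
    refine Finset.mem_Icc.2 ⟨S.min'_le i hi, ?_⟩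
    by_contra! hlt
    have h0 := (Finset.mem_filter.1 (S.min'_mem h)).2.2
    have h1 := (Finset.mem_filter.1 hi).2.1
    have h2 : (2 : ℝ)⁻¹ ^ i ≤ (2 : ℝ)⁻¹ ^ (S.min' h + 3) :=
      pow_le_pow_of_le_one (by norm_num) (by norm_num) (by omega)
    rw [pow_add] at h2
    have h3 : (0 : ℝ) < (2 : ℝ)⁻¹ ^ (S.min' h) := by positivity
    have h4 : (2 : ℝ)⁻¹ ^ 3 = 1 / 8 := by norm_num
    rw [h4] at h2
    linarith
  refine (Finset.card_le_card hsub).trans ?_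
  simp; omega

theorem exists_sum_norm_iteratedFDeriv_dyadicShell_le (E : Type) [NormedAddCommGroup E]
    [NormedSpace ℝ E] [FiniteDimensional ℝ E] [MeasurableSpace E] [BorelSpace E] (k : ℕ) :
    ∃ A > 0, ∀ (K : Set E) (x : E) (N : ℕ), ∀ j ≤ k,
      (∑ i ∈ Finset.range N, ‖iteratedFDeriv ℝ j (dyadicShell K i) x‖) *
        Metric.infDist x K ^ j ≤ A := by
  obtain ⟨C, hC, h⟩ := exists_sum_norm_iteratedFDeriv_smoothIndicator_le E k
  have hcut : ∀ (K : Set E) (x : E) (i : ℕ), ∀ j ≤ k,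
      ‖iteratedFDeriv ℝ j (dyadicCutoff K i) x‖ * ((2 : ℝ)⁻¹ ^ i) ^ j ≤ C := by
    intro K x i j hj
    have := h ({()} : Finset Unit) (fun _ => {y : E | Metric.infDist y K < 2 * (2 : ℝ)⁻¹ ^ i})
      (fun _ _ => measurableSet_infDist_lt K _) (by simp) j hj ((2 : ℝ)⁻¹ ^ i)
      (by positivity) x
    simpa [dyadicCutoff] using this
  refine ⟨3 * (6 ^ k * (2 * C)), by positivity, fun K x N j hj => ?_⟩
  set d := Metric.infDist x K with hd
  have hd0 : 0 ≤ d := Metric.infDist_nonneg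
  have hterm : ∀ i, d ≤ 3 * (2 : ℝ)⁻¹ ^ i →
      ‖iteratedFDeriv ℝ j (dyadicShell K i) x‖ * d ^ j ≤ 6 ^ k * (2 * C) := by
    intro i hi
    have hr : (0 : ℝ) < (2 : ℝ)⁻¹ ^ i := by positivity
    have e1 : iteratedFDeriv ℝ j (dyadicShell K i) x = iteratedFDeriv ℝ j (dyadicCutoff K i) x -
        iteratedFDeriv ℝ j (dyadicCutoff K (i + 1)) x :=
      iteratedFDeriv_sub_apply
        ((contDiff_dyadicCutoff K i).of_le (natCast_le_smooth j)).contDiffAt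
        ((contDiff_dyadicCutoff K (i + 1)).of_le (natCast_le_smooth j)).contDiffAt
    have h6 : (1 : ℝ) ≤ 6 ^ j := one_le_pow₀ (by norm_num)
    have h6k : (6 : ℝ) ^ j ≤ 6 ^ k := pow_le_pow_right₀ (by norm_num) hj
    -- The factor `6` instead of `3` lets the same bound serve the levels `i` and `i + 1` of a
    -- shell.
    have hbd : ∀ l, d ≤ 6 * (2 : ℝ)⁻¹ ^ l →
        ‖iteratedFDeriv ℝ j (dyadicCutoff K l) x‖ * d ^ j ≤ 6 ^ k * C := by
      intro l hl
      calc ‖iteratedFDeriv ℝ j (dyadicCutoff K l) x‖ * d ^ j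
          ≤ ‖iteratedFDeriv ℝ j (dyadicCutoff K l) x‖ * (6 * (2 : ℝ)⁻¹ ^ l) ^ j := by gcongr
        _ = 6 ^ j * (‖iteratedFDeriv ℝ j (dyadicCutoff K l) x‖ * ((2 : ℝ)⁻¹ ^ l) ^ j) := by
            rw [mul_pow]; ring
        _ ≤ 6 ^ k * C := by
            have := hcut K x l j hj
            gcongr
    calc ‖iteratedFDeriv ℝ j (dyadicShell K i) x‖ * d ^ j
        ≤ (‖iteratedFDeriv ℝ j (dyadicCutoff K i) x‖ +
          ‖iteratedFDeriv ℝ j (dyadicCutoff K (i + 1)) x‖) * d ^ j := by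
          rw [e1]; gcongr; exact norm_sub_le _ _
      _ ≤ 6 ^ k * (2 * C) := by
          have := hbd i (by linarith)
          have := hbd (i + 1) (by rw [pow_succ]; linarith)
          linarith
  rw [Finset.sum_mul, ← Finset.sum_filter_add_sum_filter_not (Finset.range N)
    (fun i => d ≤ 3 * (2 : ℝ)⁻¹ ^ i ∧ (2 : ℝ)⁻¹ ^ i ≤ 2 * d)]
  rw [Finset.sum_eq_zero (s := (Finset.range N).filter fun i =>
    ¬ (d ≤ 3 * (2 : ℝ)⁻¹ ^ i ∧ (2 : ℝ)⁻¹ ^ i ≤ 2 * d)), add_zero]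
  · refine (Finset.sum_le_card_nsmul _ _ (6 ^ k * (2 * C)) fun i hi =>
      hterm i (Finset.mem_filter.1 hi).2.1).trans ?_
    rw [nsmul_eq_mul]
    gcongr
    exact_mod_cast card_dyadic_le N
  · intro i hi
    have hi' := (Finset.mem_filter.1 hi).2
    rw [not_and_or, not_le, not_le] at hi'
    rw [iteratedFDeriv_eq_zero_of_eventuallyEq (dyadicShell_eventuallyEq_zero hi'), norm_zero,
      zero_mul]

/-- A two-level smooth partition of unity of Whitney type in the complement of a compact set. -/
theorem exists_whitney_partition {K : Set E} (hK : IsCompact K) (hne : K.Nonempty) (k : ℕ) :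
    ∃ A > 0, ∃ (T : ℕ → Finset E) (χ : ℕ → E → ℝ) (ψ : ℕ → E → E → ℝ),
      (∀ i, ∀ b ∈ T i, b ∈ K) ∧ (∀ i, ContDiff ℝ (⊤ : ℕ∞) (χ i)) ∧
      (∀ i, ∀ b ∈ T i, ContDiff ℝ (⊤ : ℕ∞) (ψ i b)) ∧
      (∀ i x, ∑ b ∈ T i, ψ i b x = 1) ∧
      (∀ x ∉ K, ∃ N, (∀ᶠ z in 𝓝 x, ∀ i ≥ N, χ i z = 0) ∧
        (Metric.infDist x K < 1 → ∀ᶠ z in 𝓝 x, ∑ i ∈ Finset.range N, χ i z = 1)) ∧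
      (∀ x N, ∀ j ≤ k, (∑ i ∈ Finset.range N, ‖iteratedFDeriv ℝ j (χ i) x‖) *
        Metric.infDist x K ^ j ≤ A) ∧
      ∀ x i, (∀ j, iteratedFDeriv ℝ j (χ i) x = 0) ∨
        ((∀ j ≤ k, (∑ b ∈ T i, ‖iteratedFDeriv ℝ j (ψ i b) x‖) * Metric.infDist x K ^ j ≤ A) ∧
          ∀ b ∈ T i, (∀ j, iteratedFDeriv ℝ j (ψ i b) x = 0) ∨
            dist x b ≤ 11 * Metric.infDist x K) := by
  obtain ⟨A, hA, hA'⟩ := exists_sum_norm_iteratedFDeriv_dyadicShell_le E k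
  obtain ⟨C, hC, hC'⟩ := exists_sum_norm_iteratedFDeriv_smoothIndicator_le E k
  choose T V hTK hVm hVd hVc hVn using fun i : ℕ =>
    hK.exists_nearest_partition hne (r := (2 : ℝ)⁻¹ ^ i) (by positivity)
  refine ⟨max A (3 ^ k * C), lt_max_of_lt_left hA, T, dyadicShell K,
    fun i b => smoothIndicator ((2 : ℝ)⁻¹ ^ i) (V i b), hTK, contDiff_dyadicShell K,
    fun i b hb => contDiff_smoothIndicator _ (hVm i b hb),
    fun i x => sum_smoothIndicator _ _ (hVm i) (hVd i) (hVc i) _ x, ?_,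
    fun x N j hj => (hA' K x N j hj).trans (le_max_left _ _), ?_⟩
  · intro x hx
    have hd : 0 < Metric.infDist x K := (hK.isClosed.notMem_iff_infDist_pos hne).1 hx
    obtain ⟨N, hN⟩ := exists_pow_lt_of_lt_one (show (0 : ℝ) < Metric.infDist x K / 3 by positivity)
      (show (2 : ℝ)⁻¹ < 1 by norm_num)
    have hN' : 3 * (2 : ℝ)⁻¹ ^ N < Metric.infDist x K := by linarith
    refine ⟨N, ?_, fun h1 => sum_dyadicShell_eventuallyEq_one h1 hN'⟩
    filter_upwards [eventually_lt_infDist hN'] with z hz i hi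
    have : (2 : ℝ)⁻¹ ^ i ≤ (2 : ℝ)⁻¹ ^ N := pow_le_pow_of_le_one (by norm_num) (by norm_num) hi
    exact dyadicShell_eq_zero (by linarith)
  · intro x i
    set d := Metric.infDist x K with hd
    have hd0 : 0 ≤ d := Metric.infDist_nonneg
    have hr : (0 : ℝ) < (2 : ℝ)⁻¹ ^ i := by positivity
    by_cases hi : 3 * (2 : ℝ)⁻¹ ^ i < d ∨ 2 * d < (2 : ℝ)⁻¹ ^ i
    · exact Or.inl (iteratedFDeriv_eq_zero_of_eventuallyEq (dyadicShell_eventuallyEq_zero hi))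
    -- Only shells with `2⁻ⁱ` comparable to `d` remain, so bounds at scale `2⁻ⁱ` become bounds at
    -- scale `d`.
    rw [not_or, not_lt, not_lt] at hi
    refine Or.inr ⟨fun j hj => le_max_of_le_right ?_, fun b hb => ?_⟩
    · have h3k : (3 : ℝ) ^ j ≤ 3 ^ k := pow_le_pow_right₀ (by norm_num) hj
      have := hC' (T i) (V i) (hVm i) (hVd i) j hj _ hr x
      set X := ∑ b ∈ T i, ‖iteratedFDeriv ℝ j (smoothIndicator ((2 : ℝ)⁻¹ ^ i) (V i b)) x‖
      have hX : 0 ≤ X := Finset.sum_nonneg fun _ _ => norm_nonneg _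
      calc X * d ^ j ≤ X * (3 * (2 : ℝ)⁻¹ ^ i) ^ j := by gcongr; exact hi.1
        _ = 3 ^ j * (X * ((2 : ℝ)⁻¹ ^ i) ^ j) := by rw [mul_pow]; ring
        _ ≤ 3 ^ k * C := by gcongr
    · by_cases hdis : Disjoint (Metric.ball x (2 * (2 : ℝ)⁻¹ ^ i)) (V i b)
      · exact Or.inl (iteratedFDeriv_eq_zero_of_eventuallyEq
          (smoothIndicator_eventuallyEq_zero hr (by linarith) hdis))
      -- With `r = 2⁻ⁱ`, `dist x b ≤ 2r + (infDist y K + r) ≤ d + 5r`, and `r ≤ 2d` gives the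
      -- constant `11`.
      · obtain ⟨y, hy, hyV⟩ := Set.not_disjoint_iff.1 hdis
        have h1 := hVn i b hb y hyV
        have h2 := Metric.infDist_le_infDist_add_dist (s := K) (x := y) (y := x)
        have h3 := dist_triangle x y b
        rw [Metric.mem_ball] at hy
        rw [dist_comm x y] at h3
        right
        linarith

end WhitneyPartition

/-! ### Whitney's extension theorem. -/

section WhitneyExtension

variable {E F : Type} [NormedAddCommGroup E] [NormedSpace ℝ E]
  [NormedAddCommGroup F] [NormedSpace ℝ F]

/-- Leibniz estimate for a sum of products in which the `i`-th derivatives of the first factors are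
of order `r⁻ⁱ` and those of the second factors of order `r ^ (k - i)`. -/
theorem norm_iteratedFDeriv_sum_smul_le {ι : Type*} {T : Finset ι} {φ : ι → E → ℝ}
    {G : ι → E → F} {k j : ℕ} (hjk : j ≤ k) {A ε r : ℝ} (hr : 0 ≤ r) (hε : 0 ≤ ε) (hA : 0 ≤ A)
    (hφ : ∀ p ∈ T, ContDiff ℝ (⊤ : ℕ∞) (φ p)) (hG : ∀ p ∈ T, ContDiff ℝ (⊤ : ℕ∞) (G p)) {x : E}
    (hφA : ∀ i ≤ k, (∑ p ∈ T, ‖iteratedFDeriv ℝ i (φ p) x‖) * r ^ i ≤ A)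
    (hGε : ∀ p ∈ T, (∀ i, iteratedFDeriv ℝ i (φ p) x = 0) ∨
      ∀ i ≤ k, ‖iteratedFDeriv ℝ i (G p) x‖ ≤ ε * r ^ (k - i)) :
    ‖iteratedFDeriv ℝ j (fun y => ∑ p ∈ T, φ p y • G p y) x‖ ≤ 2 ^ k * A * ε * r ^ (k - j) := by
  have h1 := iteratedFDeriv_sum (𝕜 := ℝ) (i := j) (u := T) (f := fun p y => φ p y • G p y)
    fun p hp => ((hφ p hp).smul (hG p hp)).of_le (natCast_le_smooth j)
  have h2 : ∀ p ∈ T, ‖iteratedFDeriv ℝ j (fun y => φ p y • G p y) x‖ ≤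
      ∑ i ∈ Finset.range (j + 1),
        (j.choose i : ℝ) * (‖iteratedFDeriv ℝ i (φ p) x‖ * r ^ i) * (ε * r ^ (k - j)) := by
    intro p hp
    refine (norm_iteratedFDeriv_smul_le (hφ p hp) (hG p hp) x (natCast_le_smooth j)).trans ?_
    refine Finset.sum_le_sum fun i hi => ?_
    have hij : i ≤ j := Nat.lt_succ_iff.1 (Finset.mem_range.1 hi)
    rcases hGε p hp with h | h
    · simp [h i]
    · have h3 := h (j - i) (by omega)
      rw [show k - (j - i) = i + (k - j) by omega, pow_add] at h3
      calc _ ≤ (j.choose i : ℝ) * ‖iteratedFDeriv ℝ i (φ p) x‖ * (ε * (r ^ i * r ^ (k - j))) := by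
            gcongr
        _ = _ := by ring
  rw [h1, Finset.sum_apply]
  refine (norm_sum_le _ _).trans ((Finset.sum_le_sum h2).trans ?_)
  rw [Finset.sum_comm]
  have h4 : ∀ i ∈ Finset.range (j + 1), ∑ p ∈ T,
      (j.choose i : ℝ) * (‖iteratedFDeriv ℝ i (φ p) x‖ * r ^ i) * (ε * r ^ (k - j)) ≤
        (j.choose i : ℝ) * (A * ε * r ^ (k - j)) := by
    intro i hi
    have hij : i ≤ j := Nat.lt_succ_iff.1 (Finset.mem_range.1 hi)
    rw [← Finset.sum_mul, ← Finset.mul_sum, ← Finset.sum_mul]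
    have := hφA i (hij.trans hjk)
    calc _ ≤ (j.choose i : ℝ) * A * (ε * r ^ (k - j)) := by gcongr
      _ = _ := by ring
  refine (Finset.sum_le_sum h4).trans ?_
  rw [← Finset.sum_mul]
  have h5 : (∑ i ∈ Finset.range (j + 1), (j.choose i : ℝ)) = 2 ^ j := by
    exact_mod_cast Nat.sum_range_choose j
  rw [h5]
  have h6 : (2 : ℝ) ^ j ≤ 2 ^ k := pow_le_pow_right₀ (by norm_num) hjk
  calc _ ≤ (2 : ℝ) ^ k * (A * ε * r ^ (k - j)) := by gcongr
    _ = _ := by ring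

/-- A Whitney field of order `k`: polynomial-like functions attached to the points of `K` whose
derivatives up to order `k` agree to the order forced by Taylor's formula. -/
def IsWhitneyField (k : ℕ) (K : Set E) (P : E → E → F) : Prop :=
  ∀ ε > 0, ∃ δ > 0, ∀ ρ, 0 < ρ → ρ < δ → ∀ a ∈ K, ∀ b ∈ K, ∀ x, dist x a ≤ ρ → dist x b ≤ ρ →
    ∀ j ≤ k, ‖iteratedFDeriv ℝ j (P a) x - iteratedFDeriv ℝ j (P b) x‖ ≤ ε * ρ ^ (k - j)

/-- The extension problem away from `K`, with control near `K`. -/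
theorem exists_extension_off [FiniteDimensional ℝ E] {K : Set E} (hK : IsCompact K)
    (hne : K.Nonempty) (k : ℕ) (P : E → E → F) (hP : ∀ a ∈ K, ContDiff ℝ (⊤ : ℕ∞) (P a)) :
    ∃ C > 0, ∃ g : E → F, (∀ x ∉ K, ContDiffAt ℝ (⊤ : ℕ∞) g x) ∧
      ∀ x ∉ K, Metric.infDist x K < 1 → ∀ a ∈ K, ∀ ε ≥ 0,
        (∀ b ∈ K, dist x b ≤ 11 * Metric.infDist x K → ∀ j ≤ k,
          ‖iteratedFDeriv ℝ j (P b) x - iteratedFDeriv ℝ j (P a) x‖ ≤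
            ε * Metric.infDist x K ^ (k - j)) →
        ∀ j ≤ k, ‖iteratedFDeriv ℝ j g x - iteratedFDeriv ℝ j (P a) x‖ ≤
          C * ε * Metric.infDist x K ^ (k - j) := by
  borelize E
  obtain ⟨A, hA, T, χ, ψ, hTK, hχ, hψ, hψ1, hχN, hχA, hact⟩ := exists_whitney_partition hK hne k
  let u : ℕ → E → F := fun i x => ∑ b ∈ T i, ψ i b x • P b x
  have hu : ∀ i, ContDiff ℝ (⊤ : ℕ∞) (u i) := fun i =>
    ContDiff.sum fun b hb => (hψ i b hb).smul (hP b (hTK i b hb))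
  let g : E → F := fun x => ∑' i, χ i x • u i x
  have hgN : ∀ x, ∀ N, (∀ᶠ z in 𝓝 x, ∀ i ≥ N, χ i z = 0) →
      g =ᶠ[𝓝 x] fun z => ∑ i ∈ Finset.range N, χ i z • u i z := by
    intro x N h
    filter_upwards [h] with z hz
    exact tsum_eq_sum fun i hi => by
      rw [hz i (by simpa using hi), zero_smul]
  refine ⟨2 ^ k * A * (2 ^ k * A), by positivity, g, fun x hx => ?_, ?_⟩
  · obtain ⟨N, hN, -⟩ := hχN x hx
    exact ContDiffAt.congr_of_eventuallyEq
      (ContDiff.sum fun i _ => (hχ i).smul (hu i)).contDiffAt (hgN x N hN)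
  intro x hx hx1 a ha ε hε hb j hj
  obtain ⟨N, hN, hN1⟩ := hχN x hx
  have hd0 : 0 ≤ Metric.infDist x K := Metric.infDist_nonneg
  -- The shells sum to one near `x`, so subtracting `P a` replaces each local average by its
  -- deviation from `P a`. The Leibniz estimate is then used twice, for the shells and for the
  -- cells, which squares `2 ^ k * A`.
  have hev : (fun z => g z - P a z) =ᶠ[𝓝 x]
      fun z => ∑ i ∈ Finset.range N, χ i z • (u i z - P a z) := by
    filter_upwards [hgN x N hN, hN1 hx1] with z hz hz1
    simp only [smul_sub, Finset.sum_sub_distrib, ← Finset.sum_smul, hz1, one_smul]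
    rw [hz]
  have hgx : ContDiffAt ℝ (⊤ : ℕ∞) g x := ContDiffAt.congr_of_eventuallyEq
      (ContDiff.sum fun i _ => (hχ i).smul (hu i)).contDiffAt (hgN x N hN)
  rw [← iteratedFDeriv_sub_apply (hgx.of_le (natCast_le_smooth j))
    ((hP a ha).contDiffAt.of_le (natCast_le_smooth j)),
    show g - P a = fun z => g z - P a z from rfl, (hev.iteratedFDeriv ℝ j).eq_of_nhds]
  rw [show 2 ^ k * A * (2 ^ k * A) * ε = 2 ^ k * A * (2 ^ k * A * ε) by ring]
  refine norm_iteratedFDeriv_sum_smul_le (φ := χ) (G := fun i z => u i z - P a z) hj hd0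
    (by positivity) hA.le (fun i _ => hχ i) (fun i _ => (hu i).sub (hP a ha))
    (fun i hi => hχA x N i hi) fun i _ => ?_
  rcases hact x i with h | ⟨hψA, hψb⟩
  · exact Or.inl h
  refine Or.inr fun l hl => ?_
  have hsub : (fun z => u i z - P a z) = fun z => ∑ b ∈ T i, ψ i b z • (P b z - P a z) := by
    ext1 z
    simp only [smul_sub, Finset.sum_sub_distrib, ← Finset.sum_smul, hψ1, one_smul, u]
  rw [hsub]
  refine norm_iteratedFDeriv_sum_smul_le hl hd0 hε hA.le (hψ i)
    (fun b hb => (hP b (hTK i b hb)).sub (hP a ha)) hψA fun b hbT => ?_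
  rcases hψb b hbT with h | h
  · exact Or.inl h
  refine Or.inr fun l hl => ?_
  have := hb b (hTK i b hbT) h l hl
  rwa [← iteratedFDeriv_sub_apply ((hP b (hTK i b hbT)).contDiffAt.of_le (natCast_le_smooth l))
    ((hP a ha).contDiffAt.of_le (natCast_le_smooth l))] at this

/-- **Whitney's extension theorem** for jets on a compact set. -/
theorem IsWhitneyField.exists_contDiff [FiniteDimensional ℝ E] {K : Set E} (hK : IsCompact K)
    {k : ℕ} {P : E → E → F} (hP : ∀ a ∈ K, ContDiff ℝ (⊤ : ℕ∞) (P a))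
    (hW : IsWhitneyField k K P) :
    ∃ g : E → F, ContDiff ℝ k g ∧
      ∀ a ∈ K, ∀ j ≤ k, iteratedFDeriv ℝ j g a = iteratedFDeriv ℝ j (P a) a := by
  classical
  rcases K.eq_empty_or_nonempty with rfl | hne
  · exact ⟨fun _ => 0, contDiff_const, by simp⟩
  obtain ⟨C, hC, g₀, hg₀, hest⟩ := exists_extension_off hK hne k P hP
  let p : E → FormalMultilinearSeries ℝ E F := fun x j =>
    if x ∈ K then iteratedFDeriv ℝ j (P x) x else iteratedFDeriv ℝ j g₀ x
  have hpK : ∀ x ∈ K, ∀ j, p x j = iteratedFDeriv ℝ j (P x) x := fun x hx j => if_pos hx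
  have hpo : ∀ x ∉ K, ∀ j, p x j = iteratedFDeriv ℝ j g₀ x := fun x hx j => if_neg hx
  have hoff : ∀ x ∉ K, ∀ j, (fun z => p z j) =ᶠ[𝓝 x] iteratedFDeriv ℝ j g₀ := by
    intro x hx j
    filter_upwards [hK.isClosed.isOpen_compl.mem_nhds hx] with z hz using hpo z hz j
  -- The jets of the candidate match those of `P a` to Whitney order at every `a ∈ K`. On `K` this
  -- is the field condition; off `K` one passes through a nearest point `b`, comparing `g₀` with `P
  -- b` and then `P b` with `P a`.
  have key : ∀ a ∈ K, ∀ ε > 0, ∀ᶠ x in 𝓝 a, ∀ j ≤ k,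
      ‖p x j - iteratedFDeriv ℝ j (P a) x‖ ≤ ε * dist x a ^ (k - j) := by
    intro a ha ε hε
    obtain ⟨δ₁, hδ₁, h₁⟩ := hW (ε / 2 / 2 ^ k) (by positivity)
    obtain ⟨δ₂, hδ₂, h₂⟩ := hW (ε / 2 / C / 11 ^ k) (by positivity)
    filter_upwards [Metric.ball_mem_nhds a (show 0 < min 1 (min (δ₁ / 2) (δ₂ / 11)) by positivity)]
      with x hx j hj
    rw [Metric.mem_ball, lt_min_iff, lt_min_iff] at hx
    obtain ⟨hx1, hxδ₁, hxδ₂⟩ := hx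
    rcases eq_or_ne x a with rfl | hxa
    · rw [hpK x ha, sub_self, norm_zero]; positivity
    have hρ : 0 < dist x a := dist_pos.2 hxa
    have hcmp : ∀ b ∈ K, dist x b ≤ dist x a →
        ‖iteratedFDeriv ℝ j (P b) x - iteratedFDeriv ℝ j (P a) x‖ ≤
          ε / 2 * dist x a ^ (k - j) := by
      intro b hb hxb
      refine (h₁ (2 * dist x a) (by positivity) (by linarith) b hb a ha x (by linarith)
        (by linarith) j hj).trans ?_
      have h2k : (2 : ℝ) ^ (k - j) ≤ 2 ^ k := pow_le_pow_right₀ (by norm_num) (by omega)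
      rw [mul_pow]
      calc ε / 2 / 2 ^ k * (2 ^ (k - j) * dist x a ^ (k - j))
          ≤ ε / 2 / 2 ^ k * (2 ^ k * dist x a ^ (k - j)) := by gcongr
        _ = ε / 2 * dist x a ^ (k - j) := by field_simp
    by_cases hxK : x ∈ K
    · rw [hpK x hxK]
      refine (hcmp x hxK (by simp)).trans ?_
      gcongr
      linarith
    · rw [hpo x hxK]
      obtain ⟨b, hbK, hbd⟩ := hK.exists_infDist_eq_dist hne x
      have hda : Metric.infDist x K ≤ dist x a := Metric.infDist_le_dist_of_mem ha
      have hdpos : 0 < Metric.infDist x K := (hK.isClosed.notMem_iff_infDist_pos hne).1 hxK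
      have hg := hest x hxK (hda.trans_lt hx1) b hbK (ε / 2 / C) (by positivity) (by
        intro c hc hxc l hl
        refine (h₂ (11 * Metric.infDist x K) (by positivity) (by linarith) c hc b hbK x hxc
          (by linarith) l hl).trans ?_
        have h11 : (11 : ℝ) ^ (k - l) ≤ 11 ^ k := pow_le_pow_right₀ (by norm_num) (by omega)
        rw [mul_pow]
        calc ε / 2 / C / 11 ^ k * (11 ^ (k - l) * Metric.infDist x K ^ (k - l))
            ≤ ε / 2 / C / 11 ^ k * (11 ^ k * Metric.infDist x K ^ (k - l)) := by gcongr
          _ = ε / 2 / C * Metric.infDist x K ^ (k - l) := by field_simp) j hj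
      have h3 : C * (ε / 2 / C) * Metric.infDist x K ^ (k - j) ≤ ε / 2 * dist x a ^ (k - j) := by
        rw [show C * (ε / 2 / C) = ε / 2 by field_simp]
        gcongr
      have h4 := hcmp b hbK (by linarith)
      have h5 := norm_add_le (iteratedFDeriv ℝ j g₀ x - iteratedFDeriv ℝ j (P b) x)
        (iteratedFDeriv ℝ j (P b) x - iteratedFDeriv ℝ j (P a) x)
      rw [sub_add_sub_cancel] at h5
      linarith
  have htaylor : HasFTaylorSeriesUpTo k (fun x => (p x 0).curry0) p := by
    constructor
    · exact fun x => rfl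
    · intro j hj x
      have hjk : j < k := by exact_mod_cast hj
      by_cases hx : x ∈ K
      · have hd : HasFDerivAt (iteratedFDeriv ℝ j (P x)) (p x j.succ).curryLeft x := by
          rw [hpK x hx]
          exact ((hP x hx).differentiable_iteratedFDeriv
            (by exact_mod_cast ENat.natCast_lt_top _) x).hasFDerivAt
        -- Since `k - j ≥ 1`, the error is `o(dist z x)`, so the candidate has the same derivative
        -- at `x` as the smooth function `P x`.
        have hlit : HasFDerivAt (fun z => p z j - iteratedFDeriv ℝ j (P x) z)
            (0 : E →L[ℝ] _) x := by
          rw [hasFDerivAt_iff_isLittleO, Asymptotics.isLittleO_iff]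
          intro c hc
          filter_upwards [key x hx c hc, Metric.ball_mem_nhds x one_pos] with z hz hz1
          have h1 := hz j hjk.le
          rw [hpK x hx, sub_self, sub_zero, zero_apply, sub_zero]
          refine h1.trans ?_
          rw [← dist_eq_norm]
          have := pow_le_of_le_one dist_nonneg (Metric.mem_ball.1 hz1).le
            (show k - j ≠ 0 by omega)
          gcongr
        have := hd.add hlit
        rw [add_zero] at this
        exact this.congr_of_eventuallyEq (Eventually.of_forall fun z => by simp)
      · have hd : HasFDerivAt (iteratedFDeriv ℝ j g₀) (p x j.succ).curryLeft x := by
          rw [hpo x hx]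
          exact ((hg₀ x hx).differentiableAt_iteratedFDeriv
            (by exact_mod_cast ENat.natCast_lt_top _)).hasFDerivAt
        exact hd.congr_of_eventuallyEq (hoff x hx j)
    · intro j hj
      have hjk : j ≤ k := by exact_mod_cast hj
      rw [continuous_iff_continuousAt]
      intro x
      by_cases hx : x ∈ K
      · have hd : ContinuousAt (iteratedFDeriv ℝ j (P x)) x :=
          ((hP x hx).continuous_iteratedFDeriv (natCast_le_smooth j)).continuousAt
        -- At `j = k` the exponent is zero, and the arbitrary factor `ε` alone gives continuity.
        have hlit : Tendsto (fun z => p z j - iteratedFDeriv ℝ j (P x) z) (𝓝 x) (𝓝 0) := by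
          rw [Metric.tendsto_nhds]
          intro ε hε
          filter_upwards [key x hx (ε / 2) (by positivity), Metric.ball_mem_nhds x one_pos]
            with z hz hz1
          have h1 := hz j hjk
          rw [dist_zero_right]
          have h2 : dist z x ^ (k - j) ≤ 1 := pow_le_one₀ dist_nonneg (Metric.mem_ball.1 hz1).le
          nlinarith
        have := hlit.add hd
        rw [zero_add, ← hpK x hx] at this
        simpa [ContinuousAt] using this
      · exact (((hg₀ x hx).differentiableAt_iteratedFDeriv
          (by exact_mod_cast ENat.natCast_lt_top _)).continuousAt).congr (hoff x hx j).symm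
  refine ⟨_, htaylor.contDiff (n := k), fun a ha j hj => ?_⟩
  rw [← hpK a ha, htaylor.eq_iteratedFDeriv (by exact_mod_cast hj)]

end WhitneyExtension

/-! ### From small exceptional sets to a Whitney field. -/

section DensityEstimates

variable {n m : ℕ}

/-- Sets of small measure in larger balls leave a dense part of a small ball uncovered. -/
theorem exists_measure_bound_dense (hn : 0 < n) {δ : ℝ} (hδ : 0 < δ) :
    ∃ η : ℝ, 0 < η ∧ ∀ (x a b : Rn n) (ρ R : ℝ) (U W : Set (Rn n)), 0 < ρ → 0 < R → R ≤ 4 * ρ →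
      volume U ≤ ENNReal.ofReal η * volume (Metric.ball a R) →
      volume W ≤ ENNReal.ofReal η * volume (Metric.ball b R) →
      ∀ y ∈ Metric.closedBall x ρ, ∃ z ∈ Metric.ball x ρ, dist y z ≤ δ * ρ ∧
        z ∉ U ∧ z ∉ W ∧ z ≠ a ∧ z ≠ b := by
  have : Nonempty (Fin n) := ⟨⟨0, hn⟩⟩
  have : Nontrivial (Rn n) := inferInstance
  set δ' := min δ 1 with hδ'
  have h0 : 0 < δ' := lt_min hδ one_pos
  have h1 : δ' ≤ 1 := min_le_right _ _
  -- A ball of radius `δ' / 2 * ρ` has volume proportional to `(δ' / 8) ^ n * (4 * ρ) ^ n`; with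
  -- this threshold the two exceptional sets together cover at most half of it.
  refine ⟨(δ' / 8) ^ n / 4, by positivity, fun x a b ρ R U W hρ hR hRρ hU hW y hy => ?_⟩
  by_contra! hcon
  -- Pulling `y` towards `x` makes room for a ball of radius `δ' / 2 * ρ` inside the ball around
  -- `x`, even if `y` is on the boundary.
  set y' := x + (1 - δ' / 2) • (y - x) with hy'
  rw [Metric.mem_closedBall, dist_eq_norm] at hy
  have hyx : dist y' x ≤ (1 - δ' / 2) * ρ := by
    rw [hy', dist_eq_norm, add_sub_cancel_left, norm_smul, Real.norm_eq_abs,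
      abs_of_nonneg (by linarith)]
    gcongr
    linarith
  have hyy : dist y y' ≤ δ' / 2 * ρ := by
    have : y - y' = (δ' / 2) • (y - x) := by
      rw [hy', sub_smul, one_smul]; abel
    rw [dist_eq_norm, this, norm_smul, Real.norm_eq_abs, abs_of_nonneg (by positivity)]
    gcongr
  have hsub : Metric.ball y' (δ' / 2 * ρ) ⊆ U ∪ W ∪ {a} ∪ {b} := by
    intro z hz
    rw [Metric.mem_ball] at hz
    have hzx : z ∈ Metric.ball x ρ := by
      rw [Metric.mem_ball]
      have := dist_triangle z y' x
      nlinarith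
    have hyz : dist y z ≤ δ * ρ := by
      have h2 := dist_triangle y y' z
      rw [dist_comm y' z] at h2
      have : δ' * ρ ≤ δ * ρ := by gcongr; exact min_le_left _ _
      linarith
    by_contra hz'
    simp only [Set.mem_union, Set.mem_singleton_iff, not_or] at hz'
    exact hz'.2 (hcon z hzx hyz hz'.1.1.1 hz'.1.1.2 hz'.1.2)
  have hvol : ∀ (c : Rn n) (r : ℝ), 0 < r → volume (Metric.ball c r) =
      ENNReal.ofReal (r ^ n) * volume (Metric.ball (0 : Rn n) 1) := by
    intro c r hr
    simpa using Measure.addHaar_ball_of_pos volume c hr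
  have hle : volume (Metric.ball y' (δ' / 2 * ρ)) ≤ volume U + volume W := by
    refine (measure_mono hsub).trans ((measure_union_le _ _).trans ?_)
    rw [measure_singleton, add_zero]
    refine (measure_union_le _ _).trans ?_
    rw [measure_singleton, add_zero]
    exact measure_union_le _ _
  have hpos : volume (Metric.ball (0 : Rn n) 1) ≠ 0 := (Metric.measure_ball_pos _ _ one_pos).ne'
  have htop : volume (Metric.ball (0 : Rn n) 1) ≠ ⊤ := measure_ball_lt_top.ne
  have h3 := hle.trans (add_le_add hU hW)
  rw [hvol _ _ (by positivity), hvol _ _ hR, hvol _ _ hR, ← mul_assoc, ← add_mul,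
    ENNReal.mul_le_mul_iff_left hpos htop, ← ENNReal.ofReal_mul (by positivity),
    ← ENNReal.ofReal_add (by positivity) (by positivity),
    ENNReal.ofReal_le_ofReal_iff (by positivity)] at h3
  have h4 : R ^ n ≤ (4 * ρ) ^ n := by gcongr
  have h5 : (δ' / 2 * ρ) ^ n = (δ' / 8) ^ n * (4 * ρ) ^ n := by
    rw [← mul_pow]; congr 1; ring
  have h6 : (δ' / 8) ^ n * R ^ n ≤ (δ' / 8) ^ n * (4 * ρ) ^ n := by gcongr
  have h7 : 0 < (δ' / 8) ^ n * (4 * ρ) ^ n := by positivity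
  linarith

theorem exists_dyadic_scale {ρ : ℝ} (hρ : 0 < ρ) {J : ℕ} (h : 2 * ρ < (2 : ℝ)⁻¹ ^ J) :
    ∃ j ≥ J, 2 * ρ ≤ (2 : ℝ)⁻¹ ^ j ∧ (2 : ℝ)⁻¹ ^ j ≤ 4 * ρ := by
  classical
  -- The scale just before the first power below `2 * ρ` is the one wanted.
  have hex : ∃ j, (2 : ℝ)⁻¹ ^ j < 2 * ρ :=
    exists_pow_lt_of_lt_one (by positivity) (by norm_num)
  have hs := Nat.find_spec hex
  have hJ : J < Nat.find hex := by
    by_contra! hle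
    have : (2 : ℝ)⁻¹ ^ J ≤ (2 : ℝ)⁻¹ ^ Nat.find hex :=
      pow_le_pow_of_le_one (by norm_num) (by norm_num) hle
    linarith
  obtain ⟨i, hi⟩ := Nat.exists_eq_succ_of_ne_zero (show Nat.find hex ≠ 0 by omega)
  refine ⟨i, by omega, not_lt.1 (Nat.find_min hex (by omega)), ?_⟩
  rw [hi, Nat.succ_eq_add_one, pow_succ] at hs
  linarith

/-- The set on which `f` differs from the polynomial with coefficients `c` by at least
`ε ‖y - x‖ ^ k`. -/
def deviationSet (k : ℕ) (f : Rn n → Rn m) (c : (Fin n → ℕ) → Rn m) (x : Rn n) (ε : ℝ) :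
    Set (Rn n) :=
  {y | ε ≤ |‖f y - centeredPoly k c x y‖ / ‖y - x‖ ^ k - 0|}

theorem norm_sub_lt_of_notMem_deviationSet {k : ℕ} {f : Rn n → Rn m} {c : (Fin n → ℕ) → Rn m}
    {x y : Rn n} {ε : ℝ} (h : y ∉ deviationSet k f c x ε) (hy : y ≠ x) :
    ‖f y - centeredPoly k c x y‖ < ε * ‖y - x‖ ^ k := by
  have hpos : 0 < ‖y - x‖ ^ k := pow_pos (norm_pos_iff.2 (sub_ne_zero.2 hy)) k
  simp only [deviationSet, Set.mem_ofPred_eq, sub_zero, not_le] at h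
  rw [abs_of_nonneg (by positivity), div_lt_iff₀ hpos] at h
  exact h

/-- Uniform approximate Taylor expansions on a set form a Whitney field. -/
theorem exists_density_isWhitneyField (hn : 0 < n) (m k : ℕ) :
    ∃ η : ℝ, 0 < η ∧ ∀ (f : Rn n → Rn m) (c : Rn n → (Fin n → ℕ) → Rn m) (K : Set (Rn n)),
      (∀ i : ℕ, ∃ J, ∀ a ∈ K, ∀ j ≥ J,
        volume (Metric.ball a ((2 : ℝ)⁻¹ ^ j) ∩ deviationSet k f (c a) a (1 / ((i : ℝ) + 1))) ≤
          ENNReal.ofReal η * volume (Metric.ball a ((2 : ℝ)⁻¹ ^ j))) →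
      IsWhitneyField k K fun a => centeredPoly k (c a) a := by
  obtain ⟨δ, hδ, C, hC, hpoly⟩ := polyFun.exists_norm_iteratedFDeriv_le (E := Rn n) (F := Rn m) k
  obtain ⟨η, hη, hdense⟩ := exists_measure_bound_dense hn hδ
  refine ⟨η, hη, fun f c K h ε hε => ?_⟩
  -- The factor `2` accounts for two polynomials compared through `f`, and `2 ^ k` for points at
  -- distance up to `2 * ρ` from `a` and `b`.
  obtain ⟨i, hi⟩ := exists_nat_one_div_lt (show 0 < ε / (C * (2 * 2 ^ k)) by positivity)
  obtain ⟨J, hJ⟩ := h i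
  set e : ℝ := 1 / ((i : ℝ) + 1) with he
  have he0 : 0 < e := by positivity
  refine ⟨(2 : ℝ)⁻¹ ^ J / 2, by positivity, fun ρ hρ hρJ a ha b hb x hxa hxb l hl => ?_⟩
  obtain ⟨j, hjJ, hj1, hj2⟩ := exists_dyadic_scale hρ (J := J) (by linarith)
  have hQ : centeredPoly k (c a) a - centeredPoly k (c b) b ∈ polyFun (Rn n) (Rn m) k :=
    Submodule.sub_mem _ (centeredPoly_mem k (c a) a) (centeredPoly_mem k (c b) b)
  have hmain := hpoly _ hQ x ρ (2 * (e * (2 * ρ) ^ k))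
    {z | ‖(centeredPoly k (c a) a - centeredPoly k (c b) b) z‖ ≤ 2 * (e * (2 * ρ) ^ k)} hρ
    (by positivity) ?_ (fun z hz => hz) l hl
  · rw [iteratedFDeriv_sub_apply
      ((polyFun.contDiff (centeredPoly_mem k (c a) a) (n := (l : ℕ∞))).contDiffAt)
      ((polyFun.contDiff (centeredPoly_mem k (c b) b) (n := (l : ℕ∞))).contDiffAt)] at hmain
    have hρl : 0 < ρ ^ l := by positivity
    refine le_of_mul_le_mul_right (hmain.trans ?_) hρl
    rw [mul_assoc ε, ← pow_add, Nat.sub_add_cancel hl, mul_pow]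
    rw [lt_div_iff₀ (by positivity)] at hi
    have := mul_le_mul_of_nonneg_right hi.le (show 0 ≤ ρ ^ k by positivity)
    linarith
  · intro y hy
    -- The dyadic radius is at least `2 * ρ`, so the balls around `a` and `b` contain the one around
    -- `x`, and at most `4 * ρ`, so their volumes stay comparable.
    obtain ⟨z, hz, hyz, hza, hzb, hz1, hz2⟩ := hdense x a b ρ _ _ _ hρ (by positivity) hj2
      (hJ a ha j hjJ) (hJ b hb j hjJ) y hy
    refine ⟨z, ?_, Metric.ball_subset_closedBall hz, hyz⟩
    rw [Metric.mem_ball] at hz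
    have hda : dist z a < 2 * ρ := by linarith [dist_triangle z x a]
    have hdb : dist z b < 2 * ρ := by linarith [dist_triangle z x b]
    have h1 := norm_sub_lt_of_notMem_deviationSet
      (fun h' => hza ⟨Metric.mem_ball.2 (by linarith), h'⟩) hz1
    have h2 := norm_sub_lt_of_notMem_deviationSet
      (fun h' => hzb ⟨Metric.mem_ball.2 (by linarith), h'⟩) hz2
    rw [← dist_eq_norm z] at h1 h2
    have h3 : dist z a ^ k ≤ (2 * ρ) ^ k := by gcongr
    have h4 : dist z b ^ k ≤ (2 * ρ) ^ k := by gcongr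
    have h5 := norm_sub_le (f z - centeredPoly k (c b) b z) (f z - centeredPoly k (c a) a z)
    rw [sub_sub_sub_cancel_left] at h5
    have h6 := mul_le_mul_of_nonneg_left h3 he0.le
    have h7 := mul_le_mul_of_nonneg_left h4 he0.le
    change ‖centeredPoly k (c a) a z - centeredPoly k (c b) b z‖ ≤ _
    linarith

end DensityEstimates

/-! ### Egorov-type exhaustion by compact sets. -/

section Exhaustion

/-- An Egorov-type exhaustion by compact sets contained in countably many increasing families. -/
theorem exists_isCompact_exhaustion {X : Type*} [TopologicalSpace X] [MeasurableSpace X]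
    [OpensMeasurableSpace X] [T2Space X] (μ : Measure X) [IsFiniteMeasure μ]
    [μ.InnerRegularCompactLTTop] {B : Set X} (hB : MeasurableSet B) {S : ℕ → ℕ → Set X}
    (hS : ∀ i j, MeasurableSet (S i j)) (hmono : ∀ i, Monotone (S i))
    (hBS : ∀ i, B ⊆ ⋃ j, S i j) :
    ∃ K : ℕ → Set X, (∀ l, IsCompact (K l)) ∧ (∀ l, K l ⊆ B) ∧ (∀ l i, ∃ j, K l ⊆ S i j) ∧
      μ (B \ ⋃ l, K l) = 0 := by
  have hsmall : ∀ i, ∀ ε : ENNReal, ε ≠ 0 → ∃ j, μ (B \ S i j) < ε := by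
    intro i ε hε
    have ht : Tendsto (fun j => μ (B \ S i j)) atTop (𝓝 (μ (⋂ j, B \ S i j))) :=
      tendsto_measure_iInter_atTop (fun j => (hB.diff (hS i j)).nullMeasurableSet)
        (fun j j' hjj => Set.sdiff_subset_sdiff_right (hmono i hjj)) ⟨0, measure_ne_top _ _⟩
    have hemp : (⋂ j, B \ S i j) = ∅ := by
      rw [← Set.sdiff_iUnion]
      exact Set.sdiff_eq_empty.2 (hBS i)
    rw [hemp, measure_empty] at ht
    exact (ht.eventually (gt_mem_nhds (pos_iff_ne_zero.2 hε))).exists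
  have hK : ∀ ε : ENNReal, ε ≠ 0 → ∃ K, IsCompact K ∧ K ⊆ B ∧ (∀ i, ∃ j, K ⊆ S i j) ∧
      μ (B \ K) ≤ ε := by
    intro ε hε
    have hε2 : ε / 2 ≠ 0 := (ENNReal.half_pos hε).ne'
    -- Half of `ε` is spread over the countably many families; the other half pays for inner
    -- regularity.
    obtain ⟨ε', hε', hsum⟩ := ENNReal.exists_pos_sum_of_countable' hε2 ℕ
    choose J hJ using fun i => hsmall i (ε' i) (hε' i).ne'
    have hD : MeasurableSet (B ∩ ⋂ i, S i (J i)) :=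
      hB.inter (MeasurableSet.iInter fun i => hS i (J i))
    obtain ⟨K, hKD, hKc, hμK⟩ := hD.exists_isCompact_sdiff_lt (measure_ne_top μ _) hε2
    refine ⟨K, hKc, hKD.trans Set.inter_subset_left, fun i => ⟨J i, fun x hx =>
      Set.mem_iInter.1 (hKD hx).2 i⟩, ?_⟩
    have hsub : B \ K ⊆ ((B ∩ ⋂ i, S i (J i)) \ K) ∪ ⋃ i, B \ S i (J i) := by
      rintro x ⟨hxB, hxK⟩
      by_cases hx : ∀ i, x ∈ S i (J i)
      · exact Or.inl ⟨⟨hxB, Set.mem_iInter.2 hx⟩, hxK⟩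
      · obtain ⟨i, hi⟩ := not_forall.1 hx
        exact Or.inr (Set.mem_iUnion.2 ⟨i, hxB, hi⟩)
    calc μ (B \ K) ≤ μ ((B ∩ ⋂ i, S i (J i)) \ K) + ∑' i, μ (B \ S i (J i)) :=
          (measure_mono hsub).trans ((measure_union_le _ _).trans
            (add_le_add le_rfl (measure_iUnion_le _)))
      _ ≤ ε / 2 + ε / 2 :=
          add_le_add hμK.le ((ENNReal.tsum_le_tsum fun i => (hJ i).le).trans hsum.le)
      _ = ε := ENNReal.add_halves ε
  choose K hKc hKB hKS hKμ using fun l : ℕ =>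
    hK ((l : ENNReal) + 1)⁻¹ (ENNReal.inv_ne_zero.2 (by finiteness))
  refine ⟨K, hKc, hKB, hKS, le_antisymm (ENNReal.le_of_forall_pos_le_add ?_) (zero_le)⟩
  intro ε hε _
  obtain ⟨l, hl⟩ := ENNReal.exists_inv_nat_lt (ENNReal.coe_pos.2 hε).ne'
  rw [zero_add]
  calc μ (B \ ⋃ l, K l) ≤ μ (B \ K l) :=
        measure_mono (Set.sdiff_subset_sdiff_right (Set.subset_iUnion K l))
    _ ≤ ((l : ENNReal) + 1)⁻¹ := hKμ l
    _ ≤ (l : ENNReal)⁻¹ := ENNReal.inv_le_inv.2 le_self_add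
    _ ≤ ε := hl.le

end Exhaustion

/-! ### Measurability and the decomposition of `B`. -/

section Main

variable {n m : ℕ}

theorem measurable_indicator_of_domRestrict {X Y : Type*} [MeasurableSpace X] [MeasurableSpace Y]
    [Zero Y] {s t : Set X} (hs : MeasurableSet s) (hst : s ⊆ t) {h : X → Y}
    (hh : Measurable (t.domRestrict h)) : Measurable (s.indicator h) := by
  refine measurable_of_restrict_of_restrict_compl hs ?_ ?_
  · have : s.domRestrict (s.indicator h) = t.domRestrict h ∘ Set.inclusion hst := by
      ext1 x
      simp [Set.domRestrict]
    rw [this]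
    exact hh.comp (measurable_inclusion hst)
  · have : sᶜ.domRestrict (s.indicator h) = fun _ => 0 := by
      ext1 x
      exact Set.indicator_of_notMem x.2 h
    rw [this]
    exact measurable_const

/-- These are the section measures of one measurable subset of the product space, which requires
coefficients that are measurable on the whole space. -/
theorem measurable_volume_ball_inter_deviationSet (k : ℕ) {f : Rn n → Rn m} (hf : Measurable f)
    {c : Rn n → (Fin n → ℕ) → Rn m} (hc : ∀ α ∈ multiIndices n k, Measurable fun x => c x α)
    (ε r : ℝ) : Measurable fun x => volume (Metric.ball x r ∩ deviationSet k f (c x) x ε) := by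
  have hcoord : ∀ i : Fin n, Measurable fun y : Rn n => y i := fun i =>
    (EuclideanSpace.proj (𝕜 := ℝ) i).continuous.measurable
  have hpoly : Measurable fun p : Rn n × Rn n => centeredPoly k (c p.1) p.1 p.2 := by
    unfold centeredPoly
    refine Finset.measurable_fun_sum _ fun α hα =>
      Measurable.fun_smul ?_ ((hc α hα).comp measurable_fst)
    refine Measurable.div_const (Finset.measurable_fun_prod _ fun i _ => ?_) _
    exact (((hcoord i).comp measurable_snd).sub ((hcoord i).comp measurable_fst)).pow_const _
  have hset : MeasurableSet {p : Rn n × Rn n | dist p.2 p.1 < r ∧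
      ε ≤ |‖f p.2 - centeredPoly k (c p.1) p.1 p.2‖ / ‖p.2 - p.1‖ ^ k - 0|} := by
    have h1 := ((hf.comp measurable_snd).sub hpoly).norm
    have h2 := ((measurable_snd (α := Rn n) (β := Rn n)).sub measurable_fst).norm.pow_const k
    have h3 : Measurable fun p : Rn n × Rn n =>
        |‖f p.2 - centeredPoly k (c p.1) p.1 p.2‖ / ‖p.2 - p.1‖ ^ k - 0| :=
      ((h1.div h2).sub_const 0).abs
    exact (measurableSet_lt (measurable_snd.dist measurable_fst) measurable_const).inter
      (measurableSet_le measurable_const h3)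
  exact measurable_measure_prodMk_left hset

theorem mainTheorem5 (n m k : ℕ) (hn : 0 < n) (hm : 0 < m) (hk : 0 < k) (s : ℝ) (hs : 0 < s)
    (f : Rn n → Rn m) (hf : Measurable f)
    (B : Set (Rn n)) (hB : MeasurableSet B) (hBfin : μH[s] B < ⊤)
    (hdiff : ∀ᵐ x ∂(μH[s] : Measure (Rn n)), x ∈ B → ApproxDifferentiableAt k f x)
    (hcoeff : ∀ α : Fin n → ℕ, ∑ i, α i ≤ k →
      Measurable ({x | x ∈ B ∧ ApproxDifferentiableAt k f x}.domRestrict (approxCoeff k f α))) :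
    ∃ (A : ℕ → Set (Rn n)) (N : Set (Rn n)),
      B = (⋃ j, A j) ∪ N ∧
      μH[s] N = 0 ∧
      ∀ j, ∃ g : Rn n → Rn m, ContDiff ℝ k g ∧
        ∀ x ∈ A j, ApproxDifferentiableAt k f x ∧
          ∀ α : Fin n → ℕ, ∑ i, α i ≤ k → approxCoeff k f α x = multiDeriv α g x := by
  obtain ⟨η, hη, hW⟩ := exists_density_isWhitneyField hn m k
  -- Removing a Borel null superset of the bad points avoids having to prove that the set of
  -- approximate differentiability is Borel.
  obtain ⟨Z, hZsub, hZm, hZ0⟩ : ∃ Z, {x | ¬ (x ∈ B → ApproxDifferentiableAt k f x)} ⊆ Z ∧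
      MeasurableSet Z ∧ μH[s] Z = 0 :=
    exists_measurable_superset_of_null (ae_iff.1 hdiff)
  obtain ⟨B₀, hB₀⟩ : ∃ B₀ : Set (Rn n), B₀ = B \ Z := ⟨_, rfl⟩
  have hB₀B : B₀ ⊆ B := hB₀ ▸ Set.sdiff_subset
  have hB₀m : MeasurableSet B₀ := hB₀ ▸ hB.diff hZm
  have hB₀d : ∀ x ∈ B₀, ApproxDifferentiableAt k f x := by
    intro x hx
    rw [hB₀] at hx
    by_contra h
    exact hx.2 (hZsub fun h' => h (h' hx.1))
  let c : Rn n → (Fin n → ℕ) → Rn m := fun x α => B₀.indicator (approxCoeff k f α) x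
  have hc : ∀ α ∈ multiIndices n k, Measurable fun x => c x α := by
    intro α hα
    have hsub : B₀ ⊆ {x | x ∈ B ∧ ApproxDifferentiableAt k f x} :=
      fun x hx => ⟨hB₀B hx, hB₀d x hx⟩
    exact measurable_indicator_of_domRestrict hB₀m hsub
      (hcoeff α (mem_multiIndices.1 hα))
  have hcT : ∀ x ∈ B₀, HasApproxTaylorAt k f (c x) x := by
    intro x hx
    have hd := hB₀d x hx
    -- On `B₀` the family is the very one selected by `approxCoeff`, so uniqueness of the Taylor
    -- polynomial is not needed.
    have : c x = hd.choose := by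
      ext1 α
      simp only [c, Set.indicator_of_mem hx, approxCoeff, dif_pos hd]
    rw [this]
    exact hd.choose_spec
  -- Restricting to dyadic radii makes the condition a countable intersection. Outside `B₀` the
  -- coefficients are zero and membership has no meaning, but the exhaustion only uses points of
  -- `B₀`.
  let S : ℕ → ℕ → Set (Rn n) := fun i J => {x | ∀ j ≥ J,
    volume (Metric.ball x ((2 : ℝ)⁻¹ ^ j) ∩ deviationSet k f (c x) x (1 / ((i : ℝ) + 1))) ≤
      ENNReal.ofReal η * volume (Metric.ball x ((2 : ℝ)⁻¹ ^ j))}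
  have hSm : ∀ i J, MeasurableSet (S i J) := by
    intro i J
    simp only [S, Set.ofPred_forall]
    refine MeasurableSet.iInter fun j => MeasurableSet.iInter fun _ => measurableSet_le
      (measurable_volume_ball_inter_deviationSet k hf hc _ _) ?_
    simp only [Measure.addHaar_ball_center]
    exact measurable_const
  have hSB : ∀ i, B₀ ⊆ ⋃ J, S i J := by
    intro i x hx
    have h1 := hcT x hx (1 / ((i : ℝ) + 1)) (by positivity)
    have h2 : Tendsto (fun j : ℕ => (2 : ℝ)⁻¹ ^ j) atTop (𝓝[>] 0) :=
      tendsto_nhdsWithin_iff.2 ⟨tendsto_pow_atTop_nhds_zero_of_lt_one (by norm_num) (by norm_num),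
        Eventually.of_forall fun j => by simp⟩
    obtain ⟨J, hJ⟩ := eventually_atTop.1 ((h1.comp h2).eventually
      (gt_mem_nhds (ENNReal.ofReal_pos.2 hη)))
    refine Set.mem_iUnion.2 ⟨J, fun j hj => ?_⟩
    have h3 := (hJ j hj).le
    rwa [Function.comp_apply, ENNReal.div_le_iff
      (Metric.measure_ball_pos _ _ (by positivity)).ne' measure_ball_lt_top.ne] at h3
  have : IsFiniteMeasure ((μH[s] : Measure (Rn n)).restrict B) := ⟨by simpa using hBfin⟩
  obtain ⟨K, hKc, hKB, hKS, hKμ⟩ := exists_isCompact_exhaustion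
    ((μH[s] : Measure (Rn n)).restrict B) hB₀m hSm
    (fun i J J' hJ x hx j hj => hx j (hJ.trans hj)) hSB
  rw [Measure.restrict_apply (hB₀m.diff (MeasurableSet.iUnion fun l => (hKc l).measurableSet)),
    Set.inter_eq_left.2 (Set.sdiff_subset.trans hB₀B)] at hKμ
  refine ⟨K, B \ ⋃ l, K l, ?_, ?_, fun l => ?_⟩
  · rw [Set.union_sdiff_cancel (Set.iUnion_subset fun l => (hKB l).trans hB₀B)]
  · refine measure_mono_null (t := (B₀ \ ⋃ l, K l) ∪ Z) ?_ (measure_union_null hKμ hZ0)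
    intro x hx
    by_cases hxZ : x ∈ Z
    · exact Or.inr hxZ
    · exact Or.inl ⟨by rw [hB₀]; exact ⟨hx.1, hxZ⟩, hx.2⟩
  · have hfield := hW f c (K l) fun i => (hKS l i).imp fun J hJ a ha => hJ ha
    obtain ⟨g, hg, hgD⟩ := hfield.exists_contDiff (hKc l)
      fun a _ => (centeredPoly_mem k (c a) a).1
    refine ⟨g, hg, fun x hx => ⟨hB₀d x (hKB l hx), fun α hα => ?_⟩⟩
    have h1 : approxCoeff k f α x = c x α := (Set.indicator_of_mem (hKB l hx) _).symm
    rw [h1, ← multiDeriv_centeredPoly k (c x) x hα, multiDeriv, multiDeriv, hgD x hx _ hα]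

end Main
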